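/- Let $\nu$ be a measure on a measurable space $\mathcal X$, $h:\mathcal X\to[0,\infty)$ and $T:\mathcal X\to\mathbb R^k$ measurable, $A(\theta)=\log\int h\,e^{\langle\theta,T\rangle}\,d\nu$, and $\Theta=\{\theta\in\mathbb R^k:|A(\theta)|<\infty\}$. The full model $F$ is the canonical exponential family with $\nu$-densities $f(x\mid\theta)=h(x)\exp\{\langle\theta,T(x)\rangle-A(\theta)\}$, $\theta\in\Theta$, assumed to be of rank $k$ (no nontrivial linear combination of the components of $T$ is almost surely constant under a member of the family). Let $M\in\mathbb R^{\ell\times k}$ have rank $\ell<k$. The nested model $N$ has densities $f(x\mid M^\top\eta)$, with $\eta\in\mathcal E=\{\eta\in\mathbb R^\ell: M^\top\eta\in\Theta\}$ and log-partition function $B(\eta)=A(M^\top\eta)$; assume $\mathcal E\neq\emptyset$. Equip $F$ and $N$ with the conjugate priors $\rho_F(\theta)\propto\exp\{\langle\tau,\theta\rangle-mA(\theta)\}$ on $\Theta$ and $\rho_N(\eta)\propto\exp\{\langle\upsilon,\eta\rangle-wB(\eta)\}$ on $\mathcal E$, normalized to be probability densities with respect to Lebesgue measure. For observations $X_1,\dots,X_n$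 the evidences are $$E_F^{(n)}=\int_\Theta\prod_{i=1}^n f(X_i\mid\theta)\,\rho_F(\theta)\,d\theta,\qquad E_N^{(n)}=\int_{\mathcal E}\prod_{i=1}^n f(X_i\mid M^\top\eta)\,\rho_N(\eta)\,d\eta .$$ Suppose that $X_1,X_2,\dots$ are i.i.d. with density $f(\cdot\mid\theta_0)$ for some $\theta_0\in\Theta$, that $\Theta$ and $\mathcal E$ are open, that $m,w>0$, that $\tau/m$ lies in the interior of the convex support (the smallest closed convex set of probability one) of $T(X_1)$, and that $\upsilon/w$ lies in the interior of the convex support of $MT(X_1)$. Write $\dot A$, $\dot B$ for the gradients. (i) If $\theta_0\in\Theta\setminus M^\top(\mathcal E)$, then there is a unique $\tilde\eta_0\in\mathcal E$ with $\dot B(\tilde\eta_0)=M\dot A(\theta_0)$, and $$n^{-1}\log\frac{E_F^{(n)}}{E_N^{(n)}}\ \xrightarrow{\;p\;}\ \langle\theta_0-M^\top\tilde\eta_0,\dot A(\theta_0)\rangle-\bigl(A(\theta_0)-A(M^\top\tilde\eta_0)\bigr)>0 .$$ (ii) If $\theta_0\in M^\top(\mathcal E)$, then $$(\log n)^{-1}\log\frac{E_F^{(n)}}{E_N^{(n)}}\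 \xrightarrow{\;p\;}\ -\frac{k-\ell}{2}<0 .$$ -/

import Mathlib

open MeasureTheory ProbabilityTheory Filter Topology
open scoped ENNReal

/-- The data of a canonical exponential family with `k`-dimensional statistic: a dominating
measure `ν` on the sample space, a carrier density `h ≥ 0` and a natural sufficient
statistic `T`. -/
structure ExpFamily (𝒳 : Type*) [MeasurableSpace 𝒳] (k : ℕ) where
  ν : Measure 𝒳
  h : 𝒳 → ℝ
  h_nonneg : ∀ x, 0 ≤ h x
  measurable_h : Measurable h
  T : 𝒳 → EuclideanSpace ℝ (Fin k)
  measurable_T : Measurable T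

/-- The convex support of a measure: the smallest closed convex set of full measure. -/
def convexSupport {E : Type*} [NormedAddCommGroup E] [NormedSpace ℝ E] [MeasurableSpace E]
    (μ : Measure E) : Set E :=
  ⋂₀ {C : Set E | IsClosed C ∧ Convex ℝ C ∧ μ Cᶜ = 0}

namespace ExpFamily

variable {𝒳 : Type*} [MeasurableSpace 𝒳] {k : ℕ}

/-- `∫ h(x) exp⟨θ, T(x)⟩ dν(x)`. -/
noncomputable def partitionFn (F : ExpFamily 𝒳 k) (θ : EuclideanSpace ℝ (Fin k)) : ℝ :=
  ∫ x, F.h x * Real.exp (inner ℝ θ (F.T x)) ∂F.ν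

/-- The log-partition function `A`. -/
noncomputable def logPartition (F : ExpFamily 𝒳 k) (θ : EuclideanSpace ℝ (Fin k)) : ℝ :=
  Real.log (F.partitionFn θ)

/-- The natural parameter space `{θ : |A(θ)| < ∞}`: the partition integral is finite and
nonzero. -/
def naturalSpace (F : ExpFamily 𝒳 k) : Set (EuclideanSpace ℝ (Fin k)) :=
  {θ | Integrable (fun x => F.h x * Real.exp (inner ℝ θ (F.T x))) F.ν ∧ 0 < F.partitionFn θ}

/-- The density `f(x | θ) = h(x) exp(⟨θ, T(x)⟩ - A(θ))` with respect to `ν`. -/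
noncomputable def density (F : ExpFamily 𝒳 k) (θ : EuclideanSpace ℝ (Fin k)) (x : 𝒳) : ℝ :=
  F.h x * Real.exp (inner ℝ θ (F.T x) - F.logPartition θ)

/-- The distribution with density `f(· | θ)`. -/
noncomputable def law (F : ExpFamily 𝒳 k) (θ : EuclideanSpace ℝ (Fin k)) : Measure 𝒳 :=
  F.ν.withDensity fun x => ENNReal.ofReal (F.density θ x)

/-- The family has rank `k`: no nontrivial affine function of the statistic vanishes almost
everywhere under any member of the family. -/
def IsFullRank (F : ExpFamily 𝒳 k) : Prop :=
  ∀ θ ∈ F.naturalSpace, ∀ (c : EuclideanSpace ℝ (Fin k)) (b : ℝ),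
    (∀ᵐ x ∂(F.law θ), inner ℝ c (F.T x) = b) → c = 0

/-- The likelihood of the first `n` observations of the sequence `x`. -/
noncomputable def likelihood (F : ExpFamily 𝒳 k) (n : ℕ) (x : ℕ → 𝒳)
    (θ : EuclideanSpace ℝ (Fin k)) : ℝ :=
  ∏ i ∈ Finset.range n, F.density θ (x i)

/-- The normalizing constant of the conjugate prior with hyperparameters `τ`, `m`. -/
noncomputable def priorConst (F : ExpFamily 𝒳 k) (τ : EuclideanSpace ℝ (Fin k)) (m : ℝ) : ℝ :=
  (∫ θ in F.naturalSpace, Real.exp (inner ℝ τ θ - m * F.logPartition θ))⁻¹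

/-- The conjugate prior density with respect to Lebesgue measure on the natural parameter
space. -/
noncomputable def prior (F : ExpFamily 𝒳 k) (τ : EuclideanSpace ℝ (Fin k)) (m : ℝ)
    (θ : EuclideanSpace ℝ (Fin k)) : ℝ :=
  F.priorConst τ m * Real.exp (inner ℝ τ θ - m * F.logPartition θ)

/-- The evidence: the likelihood integrated against the conjugate prior. -/
noncomputable def evidence (F : ExpFamily 𝒳 k) (τ : EuclideanSpace ℝ (Fin k)) (m : ℝ)
    (n : ℕ) (x : ℕ → 𝒳) : ℝ :=
  ∫ θ in F.naturalSpace, F.likelihood n x θ * F.prior τ m θ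

variable {l : ℕ}

/-- The linearly nested submodel `θ = Mᵀ η`, as the exponential family with statistic `M T`.
Its log-partition function, parameter space and densities are those of `F` at `Mᵀ η`; see
the lemmas below. -/
noncomputable def nested (F : ExpFamily 𝒳 k) (M : Matrix (Fin l) (Fin k) ℝ) :
    ExpFamily 𝒳 l where
  ν := F.ν
  h := F.h
  h_nonneg := F.h_nonneg
  measurable_h := F.measurable_h
  T := fun x => M.toEuclideanLin (F.T x)
  measurable_T :=
    (LinearMap.continuous_of_finiteDimensional M.toEuclideanLin).measurable.comp F.measurable_T

theorem inner_nested_T (F : ExpFamily 𝒳 k) (M : Matrix (Fin l) (Fin k) ℝ)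
    (η : EuclideanSpace ℝ (Fin l)) (x : 𝒳) :
    inner ℝ η ((F.nested M).T x) = inner ℝ (M.transpose.toEuclideanLin η) (F.T x) := by
  have h : M.transpose.toEuclideanLin = LinearMap.adjoint M.toEuclideanLin := by
    rw [← Matrix.toEuclideanLin_conjTranspose_eq_adjoint, Matrix.conjTranspose_eq_transpose_of_trivial]
  rw [h, LinearMap.adjoint_inner_left]
  rfl

theorem logPartition_nested (F : ExpFamily 𝒳 k) (M : Matrix (Fin l) (Fin k) ℝ)
    (η : EuclideanSpace ℝ (Fin l)) :
    (F.nested M).logPartition η = F.logPartition (M.transpose.toEuclideanLin η) := by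
  unfold logPartition partitionFn
  simp only [inner_nested_T]
  rfl

theorem naturalSpace_nested (F : ExpFamily 𝒳 k) (M : Matrix (Fin l) (Fin k) ℝ) :
    (F.nested M).naturalSpace = {η | M.transpose.toEuclideanLin η ∈ F.naturalSpace} := by
  ext η
  simp only [naturalSpace, partitionFn, Set.mem_ofPred_eq, inner_nested_T]
  rfl

theorem density_nested (F : ExpFamily 𝒳 k) (M : Matrix (Fin l) (Fin k) ℝ)
    (η : EuclideanSpace ℝ (Fin l)) (x : 𝒳) :
    (F.nested M).density η x = F.density (M.transpose.toEuclideanLin η) x := by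
  unfold density
  rw [inner_nested_T, logPartition_nested]
  rfl

end ExpFamily

/-! The likelihood is itself of the conjugate form, so an evidence is, up to the carrier factor that
both models share, the ratio of the posterior mass `∫ exp (⟨τ + s, θ'⟩ - (m + n) A θ')` to the prior
mass, where `s` is the sum of the observed statistics. Expand the exponent at a `θ` for which
`‖s - n • mean θ‖ ≤ R √n`: moving to `θ'` costs `n * KL(P_θ ‖ P_θ')`, up to a linear term of slope
at most `R √n`. The divergence is at most a multiple of `‖θ' - θ‖ ^ 2` near `θ` and at least a
multiple of `min (‖θ' - θ‖ ^ 2) ‖θ' - θ‖` everywhere, so the mass concentrates at the scale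
`1 / √n`, and in dimension `d` its logarithm is the likelihood exponent at `θ` minus
`(d / 2) log n`, up to a bounded error.

By Chebyshev's inequality this applies with high probability to the full model at `θ₀`. It applies
as well to the nested model at the `η₀` whose mean is the image under `M` of the mean at `θ₀`; this
`η₀` minimizes the divergence from `θ₀` over the nested model, and a minimizer exists because the
sublevel sets of the divergence are compact. In the difference, `n` times the divergence from `θ₀`
to `Mᵀ η₀` is the leading term unless it vanishes, and then `-((k - l) / 2) log n` remains. -/

/-! ### Exponential moments and convex supports -/

section RealExponential

theorem exp_le_one_add_add_sq_mul_exp_abs (y : ℝ) :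
    Real.exp y ≤ 1 + y + y ^ 2 * Real.exp |y| := by
  have hexp_sub_one : Real.exp y - 1 ≤ y * Real.exp y := by
    have h := mul_le_mul_of_nonneg_right (Real.add_one_le_exp (-y)) (Real.exp_pos y).le
    rw [← Real.exp_add, neg_add_cancel, Real.exp_zero] at h
    linarith
  rcases le_total 0 y with hy | hy
  · rw [abs_of_nonneg hy]
    nlinarith
  · nlinarith [mul_nonneg (neg_nonneg.2 hy) (sub_nonneg.2 (Real.add_one_le_exp y)),
      mul_nonneg (sq_nonneg y) (sub_nonneg.2 (Real.one_le_exp (abs_nonneg y)))]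

theorem monotoneOn_exp_sub_self : MonotoneOn (fun x : ℝ => Real.exp x - x) (Set.Ici 0) := by
  intro x hx y _ hxy
  have h1 : 1 ≤ Real.exp x := Real.one_le_exp hx
  have h2 : y - x + 1 ≤ Real.exp (y - x) := Real.add_one_le_exp (y - x)
  have h3 : Real.exp y = Real.exp x * Real.exp (y - x) := by rw [← Real.exp_add, add_sub_cancel]
  simp only
  nlinarith [mul_nonneg (sub_nonneg.2 h1) (sub_nonneg.2 hxy)]

theorem exp_max_zero_sub_max_zero_le (y : ℝ) :
    Real.exp (max y 0) - max y 0 ≤ Real.exp y - y := by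
  rcases le_total y 0 with hy | hy
  · rw [max_eq_right hy, Real.exp_zero]
    linarith [Real.add_one_le_exp y]
  · rw [max_eq_left hy]

theorem exp_min_sq_self_div_four_le {s : ℝ} (hs : 0 ≤ s) :
    Real.exp (min (s ^ 2) s / 4) ≤ Real.exp s - s := by
  rcases le_total s 1 with h | h
  · have hsq : s ^ 2 ≤ s := by nlinarith
    calc Real.exp (min (s ^ 2) s / 4) = Real.exp (s ^ 2 / 4) := by rw [min_eq_left hsq]
      _ ≤ 1 / (1 - s ^ 2 / 4) :=
        Real.exp_bound_div_one_sub_of_interval (by positivity) (by linarith)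
      _ ≤ 1 + s ^ 2 / 2 := by
        rw [div_le_iff₀ (by linarith)]
        nlinarith [sq_nonneg s]
      _ ≤ Real.exp s - s := by linarith [Real.quadratic_le_exp_of_nonneg hs]
  · have hexp : 1 + s ≤ Real.exp (3 / 4 * s) := by
      nlinarith [Real.quadratic_le_exp_of_nonneg (show 0 ≤ 3 / 4 * s by positivity)]
    have hsplit : Real.exp s = Real.exp (s / 4) * Real.exp (3 / 4 * s) := by
      rw [← Real.exp_add]
      ring_nf
    rw [min_eq_right (by nlinarith)]
    nlinarith [Real.one_le_exp (show 0 ≤ s / 4 by positivity)]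

end RealExponential

section ExponentialMoments

variable {𝒳 : Type*} [MeasurableSpace 𝒳] {ρ : Measure 𝒳}

theorem integrable_exp_max_zero [IsFiniteMeasure ρ] {Y : 𝒳 → ℝ}
    (h : Integrable (fun x => Real.exp (Y x)) ρ) :
    Integrable (fun x => Real.exp (max (Y x) 0)) ρ := by
  have hmax : (fun x => Real.exp (max (Y x) 0)) = (fun x => Real.exp (Y x)) ⊔ fun _ => 1 := by
    ext x
    rw [Real.exp_monotone.map_max, Real.exp_zero]
    rfl
  rw [hmax]
  exact h.sup (integrable_const 1)

theorem exp_integral_max_zero_le [IsProbabilityMeasure ρ] {Y : 𝒳 → ℝ} (hY : Integrable Y ρ)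
    (h : Integrable (fun x => Real.exp (Y x)) ρ) :
    Real.exp (∫ x, max (Y x) 0 ∂ρ) ≤ ∫ x, Real.exp (max (Y x) 0) ∂ρ :=
  convexOn_exp.map_integral_le Real.continuous_exp.continuousOn isClosed_univ
    (ae_of_all _ fun _ => Set.mem_univ _) hY.pos_part (integrable_exp_max_zero h)

theorem exp_integral_max_zero_le_integral_exp_add_one [IsProbabilityMeasure ρ] {Y : 𝒳 → ℝ}
    (hY : Integrable Y ρ) (h : Integrable (fun x => Real.exp (Y x)) ρ) :
    Real.exp (∫ x, max (Y x) 0 ∂ρ) ≤ ∫ x, Real.exp (Y x) ∂ρ + 1 := by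
  calc _ ≤ ∫ x, Real.exp (max (Y x) 0) ∂ρ := exp_integral_max_zero_le hY h
    _ ≤ ∫ x, (Real.exp (Y x) + 1) ∂ρ := by
      refine integral_mono (integrable_exp_max_zero h) (h.add (integrable_const 1)) fun x => ?_
      simp only [Real.exp_monotone.map_max, Real.exp_zero]
      exact max_le (by linarith) (by linarith [Real.exp_pos (Y x)])
    _ = _ := by
      rw [integral_add h (integrable_const 1), integral_const, probReal_univ, one_smul]

theorem exp_integral_max_zero_sub_le [IsProbabilityMeasure ρ] {Y : 𝒳 → ℝ}
    (hY : Integrable Y ρ) (h : Integrable (fun x => Real.exp (Y x)) ρ) :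
    Real.exp (∫ x, max (Y x) 0 ∂ρ) - ∫ x, max (Y x) 0 ∂ρ
      ≤ ∫ x, Real.exp (Y x) ∂ρ - ∫ x, Y x ∂ρ := by
  calc _ ≤ ∫ x, Real.exp (max (Y x) 0) ∂ρ - ∫ x, max (Y x) 0 ∂ρ := by
        gcongr
        exact exp_integral_max_zero_le hY h
    _ = ∫ x, (Real.exp (max (Y x) 0) - max (Y x) 0) ∂ρ :=
      (integral_sub (integrable_exp_max_zero h) hY.pos_part).symm
    _ ≤ ∫ x, (Real.exp (Y x) - Y x) ∂ρ :=
      integral_mono ((integrable_exp_max_zero h).sub hY.pos_part) (h.sub hY)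
        fun x => exp_max_zero_sub_max_zero_le (Y x)
    _ = _ := integral_sub h hY

section NormedSpace

variable {E : Type*} [NormedAddCommGroup E] {Z : 𝒳 → E}

theorem integrable_norm_pow_mul_exp_mul_norm (hZ : AEStronglyMeasurable Z ρ) {s t : ℝ}
    (h : Integrable (fun x => Real.exp (s * ‖Z x‖)) ρ) (hts : t < s) (n : ℕ) :
    Integrable (fun x => ‖Z x‖ ^ n * Real.exp (t * ‖Z x‖)) ρ := by
  have hneg : Integrable (fun x => Real.exp ((t - (s - t)) * ‖Z x‖)) ρ :=
    h.mono' (by fun_prop) <| ae_of_all _ fun x => by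
      rw [Real.norm_of_nonneg (Real.exp_pos _).le]
      gcongr
      linarith
  simpa only [abs_norm] using integrable_pow_abs_mul_exp_of_integrable_exp_mul
    (sub_pos.2 hts).ne' (by simpa only [add_sub_cancel] using h) hneg n

theorem integrable_norm_pow_of_integrable_exp_mul_norm (hZ : AEStronglyMeasurable Z ρ) {s : ℝ}
    (hs : 0 < s) (h : Integrable (fun x => Real.exp (s * ‖Z x‖)) ρ) (n : ℕ) :
    Integrable (fun x => ‖Z x‖ ^ n) ρ := by
  simpa only [zero_mul, Real.exp_zero, mul_one] using
    integrable_norm_pow_mul_exp_mul_norm hZ h hs n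

end NormedSpace

section InnerProductSpace

variable {E : Type*} [NormedAddCommGroup E] [InnerProductSpace ℝ E] {Z : 𝒳 → E}

theorem mul_norm_le_log_one_add_sum_exp {ι : Type*} [Fintype ι] (b : OrthonormalBasis ι ℝ E)
    {q : ℝ} (hq : 0 ≤ q) (z : E) :
    q / (Fintype.card ι + 1) * ‖z‖ ≤
      Real.log (1 + ∑ i, (Real.exp (q * inner ℝ (b i) z) + Real.exp (-(q * inner ℝ (b i) z)))) := by
  set W := 1 + ∑ i, (Real.exp (q * inner ℝ (b i) z) + Real.exp (-(q * inner ℝ (b i) z)))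
  have hterm : ∀ i ∈ Finset.univ,
      0 ≤ Real.exp (q * inner ℝ (b i) z) + Real.exp (-(q * inner ℝ (b i) z)) :=
    fun i _ => by positivity
  have hW1 : 1 ≤ W := le_add_of_nonneg_right (Finset.sum_nonneg hterm)
  have hcoord (i : ι) : q * ‖inner ℝ (b i) z‖ ≤ Real.log W := by
    have habs : q * ‖inner ℝ (b i) z‖ = |q * inner ℝ (b i) z| := by
      rw [abs_mul, abs_of_nonneg hq, Real.norm_eq_abs]
    rw [Real.le_log_iff_exp_le (by linarith), habs]
    linarith [Real.exp_abs_le (q * inner ℝ (b i) z),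
      Finset.single_le_sum hterm (Finset.mem_univ i)]
  have hnorm : ‖z‖ ≤ ∑ i, ‖inner ℝ (b i) z‖ := by
    conv_lhs => rw [← b.sum_repr' z]
    refine (norm_sum_le _ _).trans_eq (Finset.sum_congr rfl fun i _ => ?_)
    rw [norm_smul, b.norm_eq_one, mul_one]
  rw [div_mul_eq_mul_div, div_le_iff₀ (by positivity)]
  calc q * ‖z‖ ≤ ∑ i, q * ‖inner ℝ (b i) z‖ := by
        rw [← Finset.mul_sum]
        gcongr
    _ ≤ ∑ _i : ι, Real.log W := Finset.sum_le_sum fun i _ => hcoord i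
    _ = Real.log W * Fintype.card ι := by
      rw [Finset.sum_const, Finset.card_univ, nsmul_eq_mul, mul_comm]
    _ ≤ Real.log W * (Fintype.card ι + 1) := by
      have := Real.log_nonneg hW1
      gcongr
      linarith

theorem exists_integrable_exp_mul_norm [FiniteDimensional ℝ E] [IsFiniteMeasure ρ]
    (hZ : AEStronglyMeasurable Z ρ) {r : ℝ} (hr : 0 < r)
    (h : ∀ v : E, ‖v‖ < r → Integrable (fun x => Real.exp (inner ℝ v (Z x))) ρ) :
    ∃ s > 0, Integrable (fun x => Real.exp (s * ‖Z x‖)) ρ := by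
  let b := stdOrthonormalBasis ℝ E
  have hcoord (i) (c : ℝ) (hc : |c| = r / 2) :
      Integrable (fun x => Real.exp (c * inner ℝ (b i) (Z x))) ρ := by
    simpa only [real_inner_smul_left] using h (c • b i) (by
      rw [norm_smul, b.norm_eq_one, mul_one, Real.norm_eq_abs, hc]
      linarith)
  have hr2 : |r / 2| = r / 2 := abs_of_pos (by positivity)
  have hdom : Integrable (fun x => 1 + ∑ i, (Real.exp (r / 2 * inner ℝ (b i) (Z x))
      + Real.exp (-(r / 2 * inner ℝ (b i) (Z x))))) ρ := by
    refine (integrable_const _).add (integrable_finsetSum _ fun i _ => (hcoord i _ hr2).add ?_)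
    simpa only [neg_mul] using hcoord i (-(r / 2)) (by rw [abs_neg, hr2])
  refine ⟨r / 2 / (Fintype.card (Fin (Module.finrank ℝ E)) + 1), by positivity,
    hdom.mono' (by fun_prop) (ae_of_all _ fun x => ?_)⟩
  rw [Real.norm_of_nonneg (Real.exp_pos _).le, ← Real.le_log_iff_exp_le (by positivity)]
  exact mul_norm_le_log_one_add_sum_exp b (by positivity) (Z x)

theorem integral_exp_inner_le [IsProbabilityMeasure ρ] [CompleteSpace E] (hZ : Integrable Z ρ)
    (hmean : ∫ x, Z x ∂ρ = 0) {t : ℝ}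
    (h : Integrable (fun x => ‖Z x‖ ^ 2 * Real.exp (t * ‖Z x‖)) ρ) {v : E} (hv : ‖v‖ ≤ t) :
    ∫ x, Real.exp (inner ℝ v (Z x)) ∂ρ
      ≤ 1 + ‖v‖ ^ 2 * ∫ x, ‖Z x‖ ^ 2 * Real.exp (t * ‖Z x‖) ∂ρ := by
  have hbound (x : 𝒳) : Real.exp (inner ℝ v (Z x)) ≤
      1 + inner ℝ v (Z x) + ‖v‖ ^ 2 * (‖Z x‖ ^ 2 * Real.exp (t * ‖Z x‖)) := by
    have hCS : |inner ℝ v (Z x)| ≤ ‖v‖ * ‖Z x‖ := abs_real_inner_le_norm v (Z x)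
    calc _ ≤ 1 + inner ℝ v (Z x) + |inner ℝ v (Z x)| ^ 2 * Real.exp |inner ℝ v (Z x)| := by
          rw [sq_abs]
          exact exp_le_one_add_add_sq_mul_exp_abs _
      _ ≤ 1 + inner ℝ v (Z x) + (‖v‖ * ‖Z x‖) ^ 2 * Real.exp (t * ‖Z x‖) := by
          gcongr
          exact hCS.trans (by gcongr)
      _ = _ := by ring
  have hlin : Integrable (fun x => 1 + inner ℝ v (Z x)) ρ :=
    (integrable_const 1).add (hZ.const_inner v)
  calc _ ≤ ∫ x, (1 + inner ℝ v (Z x) + ‖v‖ ^ 2 * (‖Z x‖ ^ 2 * Real.exp (t * ‖Z x‖))) ∂ρ :=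
        integral_mono_of_nonneg (ae_of_all _ fun x => (Real.exp_pos _).le)
          (hlin.add (h.const_mul _)) (ae_of_all _ hbound)
    _ = _ := by
      rw [integral_add hlin (h.const_mul _), integral_add (integrable_const 1) (hZ.const_inner v),
        integral_inner hZ, hmean, inner_zero_right, integral_const_mul, integral_const,
        probReal_univ, one_smul, add_zero]

theorem lipschitz_integral_max_inner_zero (hZ : Integrable Z ρ) :
    LipschitzWith (∫ x, ‖Z x‖ ∂ρ).toNNReal fun u : E => ∫ x, max (inner ℝ u (Z x)) 0 ∂ρ := by
  refine LipschitzWith.of_dist_le_mul fun u v => ?_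
  rw [Real.coe_toNNReal _ (integral_nonneg fun _ => norm_nonneg _), dist_eq_norm, dist_eq_norm,
    ← integral_sub (hZ.const_inner u).pos_part (hZ.const_inner v).pos_part, ← integral_mul_const]
  refine norm_integral_le_of_norm_le (hZ.norm.mul_const _) (ae_of_all _ fun x => ?_)
  calc _ ≤ |inner ℝ u (Z x) - inner ℝ v (Z x)| := abs_max_sub_max_le_abs _ _ _
    _ = |inner ℝ (u - v) (Z x)| := by rw [inner_sub_left]
    _ ≤ ‖Z x‖ * ‖u - v‖ := (abs_real_inner_le_norm _ _).trans_eq (mul_comm _ _)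

theorem exists_mul_norm_le_integral_max_inner_zero [FiniteDimensional ℝ E] (hZ : Integrable Z ρ)
    (h : ∀ u : E, u ≠ 0 → ¬ ∀ᵐ x ∂ρ, inner ℝ u (Z x) ≤ 0) :
    ∃ a > 0, ∀ v : E, a * ‖v‖ ≤ ∫ x, max (inner ℝ v (Z x)) 0 ∂ρ := by
  have hpos : ∀ u ∈ Metric.sphere (0 : E) 1, 0 < ∫ x, max (inner ℝ u (Z x)) 0 ∂ρ := by
    intro u hu
    refine (integral_nonneg fun x => le_max_right _ _).lt_of_ne' fun hzero => ?_
    refine h u (ne_zero_of_mem_unit_sphere ⟨u, hu⟩) ?_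
    filter_upwards [(integral_eq_zero_iff_of_nonneg (fun x => le_max_right _ _)
      (hZ.const_inner u).pos_part).1 hzero] with x hx
    exact max_eq_right_iff.1 hx
  obtain ⟨a, ha, hle⟩ := (isCompact_sphere (0 : E) 1).exists_forall_le'
    (lipschitz_integral_max_inner_zero hZ).continuous.continuousOn hpos
  refine ⟨a, ha, fun v => ?_⟩
  rcases eq_or_ne v 0 with rfl | hv
  · simp
  have hscale : ∫ x, max (inner ℝ (‖v‖⁻¹ • v) (Z x)) 0 ∂ρ
      = ‖v‖⁻¹ * ∫ x, max (inner ℝ v (Z x)) 0 ∂ρ := by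
    simp only [← integral_const_mul, real_inner_smul_left,
      mul_max_of_nonneg _ _ (inv_nonneg.2 (norm_nonneg v)), mul_zero]
  have hunit := hle (‖v‖⁻¹ • v) (by simp [norm_smul, hv])
  rwa [hscale, inv_mul_eq_div, le_div_iff₀ (norm_pos_iff.2 hv)] at hunit

end InnerProductSpace

end ExponentialMoments

section ConvexSupport

variable {𝒳 : Type*} [MeasurableSpace 𝒳] {ρ : Measure 𝒳} {E : Type*} [NormedAddCommGroup E]
  [MeasurableSpace E]

theorem convexSupport_subset_of_absolutelyContinuous [NormedSpace ℝ E] {μ μ' : Measure E}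
    (h : μ ≪ μ') : convexSupport μ ⊆ convexSupport μ' :=
  fun _ hp C hC => hp C ⟨hC.1, hC.2.1, h hC.2.2⟩

variable [InnerProductSpace ℝ E] [BorelSpace E]

theorem not_ae_inner_sub_nonpos_of_mem_interior_convexSupport {Y : 𝒳 → E}
    (hY : AEMeasurable Y ρ) {p : E} (hp : p ∈ interior (convexSupport (ρ.map Y)))
    {u : E} (hu : u ≠ 0) : ¬ ∀ᵐ x ∂ρ, inner ℝ u (Y x - p) ≤ 0 := by
  intro hae
  let C : Set E := {y | inner ℝ u y ≤ inner ℝ u p}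
  have hC_closed : IsClosed C := isClosed_le (by fun_prop) continuous_const
  have hC_convex : Convex ℝ C := convex_halfSpace_le (innerSL ℝ u).toLinearMap.isLinear _
  have hC_full : ρ.map Y Cᶜ = 0 := by
    rw [Measure.map_apply_of_aemeasurable hY hC_closed.measurableSet.compl]
    filter_upwards [hae] with x hx
    rw [inner_sub_right, sub_nonpos] at hx
    exact hx
  have hC_nhds : C ∈ 𝓝 p := mem_of_superset (mem_interior_iff_mem_nhds.1 hp)
    fun y hy => hy C ⟨hC_closed, hC_convex, hC_full⟩
  have htendsto : Tendsto (fun t : ℝ => p + t • u) (𝓝[>] 0) (𝓝 p) := by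
    have hcont : Continuous fun t : ℝ => p + t • u := by fun_prop
    simpa only [zero_smul, add_zero] using (hcont.tendsto 0).mono_left nhdsWithin_le_nhds
  obtain ⟨t, hmem, ht⟩ := ((htendsto.eventually_mem hC_nhds).and self_mem_nhdsWithin).exists
  have hle : inner ℝ u (p + t • u) ≤ inner ℝ u p := hmem
  rw [inner_add_right, real_inner_smul_right, add_le_iff_nonpos_right] at hle
  exact (mul_pos ht (real_inner_self_pos.2 hu)).not_ge hle

end ConvexSupport

theorem integrable_exp_neg_mul_norm {E : Type*} [NormedAddCommGroup E] [NormedSpace ℝ E]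
    [FiniteDimensional ℝ E] [MeasurableSpace E] [BorelSpace E] (μ : Measure E)
    [μ.IsAddHaarMeasure] {c : ℝ} (hc : 0 < c) :
    Integrable (fun x : E => Real.exp (-(c * ‖x‖))) μ := by
  have hcont : Continuous fun x : E => Real.exp (-(c * ‖x‖)) := by fun_prop
  refine hcont.locallyIntegrable.integrable_of_isBigO_cocompact
    (g := fun x : E => (1 + ‖x‖) ^ (-(Module.finrank ℝ E + 1 : ℝ))) ?_
    ((integrable_one_add_norm (lt_add_one _)).integrableAtFilter _)
  have htop : Tendsto (fun x : E => 1 + ‖x‖) (cocompact E) atTop :=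
    tendsto_atTop_add_const_left _ _ tendsto_norm_cocompact_atTop
  have hshift : (fun x : E => Real.exp (-(c * ‖x‖)))
      = fun x => Real.exp c * Real.exp (-c * (1 + ‖x‖)) := by
    ext x
    rw [← Real.exp_add]
    ring_nf
  rw [hshift]
  exact ((isLittleO_exp_neg_mul_rpow_atTop hc _).isBigO.comp_tendsto htop).const_mul_left _

/-! ### Means, divergences and the log-partition function -/

namespace ExpFamily

variable {𝒳 : Type*} [MeasurableSpace 𝒳] {d : ℕ} (G : ExpFamily 𝒳 d)
  {θ θ' : EuclideanSpace ℝ (Fin d)}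

/-- The mean of the sufficient statistic under the member `θ`. -/
noncomputable def mean (θ : EuclideanSpace ℝ (Fin d)) : EuclideanSpace ℝ (Fin d) :=
  ∫ x, G.T x ∂(G.law θ)

/-- The Kullback-Leibler divergence `KL(P_θ ‖ P_θ')` between two members of the family, written as
the Bregman divergence of the log-partition function. -/
noncomputable def divergence (θ θ' : EuclideanSpace ℝ (Fin d)) : ℝ :=
  G.logPartition θ' - G.logPartition θ - inner ℝ (G.mean θ) (θ' - θ)

theorem measurable_density (θ : EuclideanSpace ℝ (Fin d)) : Measurable (G.density θ) :=
  G.measurable_h.mul (G.measurable_T.const_inner.sub_const _).exp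

theorem density_nonneg (θ : EuclideanSpace ℝ (Fin d)) (x : 𝒳) : 0 ≤ G.density θ x :=
  mul_nonneg (G.h_nonneg x) (Real.exp_pos _).le

theorem density_pos_iff (θ : EuclideanSpace ℝ (Fin d)) (x : 𝒳) :
    0 < G.density θ x ↔ 0 < G.h x :=
  mul_pos_iff_of_pos_right (Real.exp_pos _)

theorem density_mul_exp_inner_sub (θ θ' p : EuclideanSpace ℝ (Fin d)) (x : 𝒳) :
    G.density θ x * Real.exp (inner ℝ (θ' - θ) (G.T x - p)) =
      Real.exp (-G.logPartition θ - inner ℝ p (θ' - θ))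
        * (G.h x * Real.exp (inner ℝ θ' (G.T x))) := by
  rw [density, mul_assoc, ← Real.exp_add, mul_left_comm, ← Real.exp_add, inner_sub_left,
    inner_sub_right, inner_sub_right, inner_sub_right, real_inner_comm θ' p, real_inner_comm θ p]
  ring_nf

theorem integrable_law_iff {f : 𝒳 → ℝ} :
    Integrable f (G.law θ) ↔ Integrable (fun x => G.density θ x * f x) G.ν := by
  rw [law, integrable_withDensity_iff_integrable_smul' (G.measurable_density θ).ennreal_ofReal
    (ae_of_all _ fun _ => ENNReal.ofReal_lt_top)]
  simp only [ENNReal.toReal_ofReal (G.density_nonneg θ _), smul_eq_mul]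

theorem integral_law (f : 𝒳 → ℝ) :
    ∫ x, f x ∂(G.law θ) = ∫ x, G.density θ x * f x ∂G.ν := by
  rw [law, integral_withDensity_eq_integral_toReal_smul (G.measurable_density θ).ennreal_ofReal
    (ae_of_all _ fun _ => ENNReal.ofReal_lt_top)]
  simp only [ENNReal.toReal_ofReal (G.density_nonneg θ _), smul_eq_mul]

theorem integrable_exp_inner_sub_law (θ p : EuclideanSpace ℝ (Fin d))
    (hθ' : θ' ∈ G.naturalSpace) :
    Integrable (fun x => Real.exp (inner ℝ (θ' - θ) (G.T x - p))) (G.law θ) := by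
  rw [integrable_law_iff]
  simp only [density_mul_exp_inner_sub]
  exact hθ'.1.const_mul _

theorem integral_exp_inner_sub_law (θ p : EuclideanSpace ℝ (Fin d))
    (hθ' : θ' ∈ G.naturalSpace) :
    ∫ x, Real.exp (inner ℝ (θ' - θ) (G.T x - p)) ∂(G.law θ) =
      Real.exp (G.logPartition θ' - G.logPartition θ - inner ℝ p (θ' - θ)) := by
  have hA : Real.exp (G.logPartition θ') = G.partitionFn θ' := Real.exp_log hθ'.2
  rw [integral_law]
  simp only [density_mul_exp_inner_sub]
  rw [integral_const_mul, ← partitionFn, ← hA, ← Real.exp_add]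
  ring_nf

theorem exp_divergence (θ : EuclideanSpace ℝ (Fin d)) (hθ' : θ' ∈ G.naturalSpace) :
    Real.exp (G.divergence θ θ') =
      ∫ x, Real.exp (inner ℝ (θ' - θ) (G.T x - G.mean θ)) ∂(G.law θ) :=
  (G.integral_exp_inner_sub_law θ _ hθ').symm

theorem isProbabilityMeasure_law (hθ : θ ∈ G.naturalSpace) : IsProbabilityMeasure (G.law θ) := by
  rw [isProbabilityMeasure_iff_real]
  simpa using G.integral_exp_inner_sub_law θ 0 hθ

theorem law_absolutelyContinuous (θ θ' : EuclideanSpace ℝ (Fin d)) : G.law θ ≪ G.law θ' := by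
  intro s hs
  rw [law, withDensity_apply_eq_zero (G.measurable_density _).ennreal_ofReal] at hs ⊢
  simpa only [ne_eq, ENNReal.ofReal_eq_zero, not_le, density_pos_iff] using hs

theorem ae_h_pos (θ : EuclideanSpace ℝ (Fin d)) : ∀ᵐ x ∂(G.law θ), 0 < G.h x := by
  rw [law, ae_withDensity_iff (G.measurable_density θ).ennreal_ofReal]
  refine ae_of_all _ fun x hx => ?_
  rwa [ne_eq, ENNReal.ofReal_eq_zero, not_le, density_pos_iff] at hx

section NaturalSpace

variable {G}

theorem mem_naturalSpace_iff_integrable_exp_inner_sub (hθ : θ ∈ G.naturalSpace)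
    (p : EuclideanSpace ℝ (Fin d)) :
    θ' ∈ G.naturalSpace ↔
      Integrable (fun x => Real.exp (inner ℝ (θ' - θ) (G.T x - p))) (G.law θ) := by
  refine ⟨G.integrable_exp_inner_sub_law θ p, fun h => ?_⟩
  have := G.isProbabilityMeasure_law hθ
  have hpos := integral_exp_pos h
  rw [integral_law] at hpos
  rw [integrable_law_iff] at h
  simp only [density_mul_exp_inner_sub] at h hpos
  rw [integral_const_mul] at hpos
  exact ⟨(integrable_const_mul_iff (Real.exp_pos _).ne'.isUnit _).1 h,
    pos_of_mul_pos_right hpos (Real.exp_pos _).le⟩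

theorem convex_naturalSpace (G : ExpFamily 𝒳 d) : Convex ℝ G.naturalSpace := by
  rw [convex_iff_segment_subset]
  intro θ hθ θ' hθ'
  rw [segment_eq_image']
  rintro _ ⟨t, ht, rfl⟩
  have hmem (s : ℝ) : θ + s • (θ' - θ) ∈ G.naturalSpace ↔
      s ∈ integrableExpSet (fun x => inner ℝ (θ' - θ) (G.T x)) (G.law θ) := by
    rw [mem_naturalSpace_iff_integrable_exp_inner_sub hθ 0]
    simp only [add_sub_cancel_left, sub_zero, real_inner_smul_left]
    rfl
  have h0 := (hmem 0).1 (by simpa using hθ)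
  have h1 := (hmem 1).1 (by simpa using hθ')
  exact (hmem t).2 (convex_integrableExpSet.ordConnected.out h0 h1 ht)

theorem restrict_interior_naturalSpace (G : ExpFamily 𝒳 d) :
    volume.restrict (interior G.naturalSpace) = volume.restrict G.naturalSpace :=
  Measure.restrict_congr_set <| interior_ae_eq_of_null_frontier <|
    G.convex_naturalSpace.addHaar_frontier volume

end NaturalSpace

section Interior

variable {G}

theorem exists_integrable_exp_mul_norm_sub (hθ : θ ∈ interior G.naturalSpace)
    (p : EuclideanSpace ℝ (Fin d)) :
    ∃ s > 0, Integrable (fun x => Real.exp (s * ‖G.T x - p‖)) (G.law θ) := by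
  have := G.isProbabilityMeasure_law (interior_subset hθ)
  obtain ⟨r, hr, hball⟩ := Metric.mem_nhds_iff.1 (mem_interior_iff_mem_nhds.1 hθ)
  refine exists_integrable_exp_mul_norm (G.measurable_T.sub_const p).aestronglyMeasurable hr
    fun v hv => ?_
  have hmem : θ + v ∈ G.naturalSpace := hball (by simpa [dist_eq_norm] using hv)
  simpa only [add_sub_cancel_left] using G.integrable_exp_inner_sub_law θ p hmem

theorem memLp_T_sub (hθ : θ ∈ interior G.naturalSpace) (p : EuclideanSpace ℝ (Fin d)) :
    MemLp (fun x => G.T x - p) 2 (G.law θ) := by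
  have hmeas := (G.measurable_T.sub_const p).aestronglyMeasurable (μ := G.law θ)
  obtain ⟨s, hs, h⟩ := exists_integrable_exp_mul_norm_sub hθ p
  exact (memLp_two_iff_integrable_sq_norm hmeas).2
    (integrable_norm_pow_of_integrable_exp_mul_norm hmeas hs h 2)

theorem integrable_T_sub (hθ : θ ∈ interior G.naturalSpace) (p : EuclideanSpace ℝ (Fin d)) :
    Integrable (fun x => G.T x - p) (G.law θ) :=
  have := G.isProbabilityMeasure_law (interior_subset hθ)
  (memLp_T_sub hθ p).integrable one_le_two

theorem integral_T_sub (hθ : θ ∈ interior G.naturalSpace) (p : EuclideanSpace ℝ (Fin d)) :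
    ∫ x, (G.T x - p) ∂(G.law θ) = G.mean θ - p := by
  have := G.isProbabilityMeasure_law (interior_subset hθ)
  have hT : Integrable G.T (G.law θ) := by simpa only [sub_zero] using integrable_T_sub hθ 0
  rw [integral_sub hT (integrable_const _), integral_const, probReal_univ, one_smul, mean]

theorem inner_mean_sub_le (hθ : θ ∈ interior G.naturalSpace) (hθ' : θ' ∈ G.naturalSpace)
    (p : EuclideanSpace ℝ (Fin d)) :
    inner ℝ (θ' - θ) (G.mean θ - p)
      ≤ G.logPartition θ' - G.logPartition θ - inner ℝ p (θ' - θ) := by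
  have := G.isProbabilityMeasure_law (interior_subset hθ)
  have hT := integrable_T_sub hθ p
  rw [← Real.exp_le_exp, ← G.integral_exp_inner_sub_law θ p hθ', ← integral_T_sub hθ p,
    ← integral_inner hT]
  exact convexOn_exp.map_integral_le Real.continuous_exp.continuousOn isClosed_univ
    (ae_of_all _ fun _ => Set.mem_univ _) (hT.const_inner _)
    (G.integrable_exp_inner_sub_law θ p hθ')

theorem divergence_nonneg (hθ : θ ∈ interior G.naturalSpace) (hθ' : θ' ∈ G.naturalSpace) :
    0 ≤ G.divergence θ θ' := by
  simpa only [divergence, sub_self, inner_zero_right] using inner_mean_sub_le hθ hθ' (G.mean θ)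

theorem exists_divergence_le (hθ : θ ∈ interior G.naturalSpace) :
    ∃ C ≥ 0, ∀ᶠ θ' in 𝓝 θ, G.divergence θ θ' ≤ C * ‖θ' - θ‖ ^ 2 := by
  have := G.isProbabilityMeasure_law (interior_subset hθ)
  obtain ⟨s, hs, hexp⟩ := exists_integrable_exp_mul_norm_sub hθ (G.mean θ)
  have hsq := integrable_norm_pow_mul_exp_mul_norm
    (G.measurable_T.sub_const (G.mean θ)).aestronglyMeasurable hexp (half_lt_self hs) 2
  refine ⟨∫ x, ‖G.T x - G.mean θ‖ ^ 2 * Real.exp (s / 2 * ‖G.T x - G.mean θ‖) ∂(G.law θ),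
    integral_nonneg fun x => by positivity, ?_⟩
  filter_upwards [mem_interior_iff_mem_nhds.1 hθ,
    Metric.closedBall_mem_nhds θ (half_pos hs)] with θ' hmem hdist
  have hexp_le := integral_exp_inner_le (integrable_T_sub hθ (G.mean θ))
    (by rw [integral_T_sub hθ, sub_self]) hsq (mem_closedBall_iff_norm.1 hdist)
  rw [← G.exp_divergence θ hmem] at hexp_le
  linarith [Real.add_one_le_exp (G.divergence θ θ')]

theorem hasGradientAt_logPartition (hθ : θ ∈ interior G.naturalSpace) :
    HasGradientAt G.logPartition (G.mean θ) θ := by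
  obtain ⟨C, -, hC⟩ := exists_divergence_le hθ
  have hbigO : (fun θ' => G.divergence θ θ') =O[𝓝 θ] fun θ' => ‖θ' - θ‖ ^ 2 := by
    refine Asymptotics.IsBigO.of_bound C ?_
    filter_upwards [hC, mem_interior_iff_mem_nhds.1 hθ] with θ' hle hmem
    rwa [Real.norm_of_nonneg (divergence_nonneg hθ hmem), Real.norm_of_nonneg (by positivity)]
  have hlittleO : (fun θ' => ‖θ' - θ‖ ^ 2) =o[𝓝 θ] fun θ' => ‖θ' - θ‖ ^ 1 :=
    (Asymptotics.isLittleO_pow_pow one_lt_two).comp_tendsto (tendsto_norm_sub_self θ)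
  rw [hasGradientAt_iff_isLittleO]
  refine hbigO.trans_isLittleO ?_
  simpa using hlittleO.norm_right

theorem gradient_logPartition (hθ : θ ∈ interior G.naturalSpace) :
    gradient G.logPartition θ = G.mean θ := (hasGradientAt_logPartition hθ).gradient

theorem continuousOn_logPartition (G : ExpFamily 𝒳 d) :
    ContinuousOn G.logPartition (interior G.naturalSpace) := fun _ hθ =>
  (hasGradientAt_logPartition hθ).continuousAt.continuousWithinAt

theorem not_ae_inner_sub_mean_nonpos (hG : G.IsFullRank) (hθ : θ ∈ interior G.naturalSpace)
    {u : EuclideanSpace ℝ (Fin d)} (hu : u ≠ 0) :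
    ¬ ∀ᵐ x ∂(G.law θ), inner ℝ u (G.T x - G.mean θ) ≤ 0 := by
  intro hae
  have hint := (integrable_T_sub hθ (G.mean θ)).const_inner (𝕜 := ℝ) u
  have hzero : ∫ x, -inner ℝ u (G.T x - G.mean θ) ∂(G.law θ) = 0 := by
    rw [integral_neg, integral_inner (integrable_T_sub hθ _), integral_T_sub hθ, sub_self,
      inner_zero_right, neg_zero]
  refine hu (hG θ (interior_subset hθ) u (inner ℝ u (G.mean θ)) ?_)
  filter_upwards [(integral_eq_zero_iff_of_nonneg_ae
    (hae.mono fun x hx => neg_nonneg.2 hx) hint.neg).1 hzero] with x hx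
  rwa [Pi.zero_apply, neg_eq_zero, inner_sub_right, sub_eq_zero] at hx

theorem exists_le_divergence (hG : G.IsFullRank) (hθ : θ ∈ interior G.naturalSpace) :
    ∃ c > 0, ∀ θ' ∈ G.naturalSpace,
      c * min (‖θ' - θ‖ ^ 2) ‖θ' - θ‖ ≤ G.divergence θ θ' := by
  have := G.isProbabilityMeasure_law (interior_subset hθ)
  have hT := integrable_T_sub hθ (G.mean θ)
  obtain ⟨a, ha, hcoercive⟩ := exists_mul_norm_le_integral_max_inner_zero hT
    fun u hu => not_ae_inner_sub_mean_nonpos hG hθ hu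
  refine ⟨min (a ^ 2) a / 4, by positivity, fun θ' hθ' => ?_⟩
  set r := ‖θ' - θ‖
  have hr : 0 ≤ a * r := by positivity
  have hmean : ∫ x, inner ℝ (θ' - θ) (G.T x - G.mean θ) ∂(G.law θ) = 0 := by
    rw [integral_inner hT, integral_T_sub hθ, sub_self, inner_zero_right]
  have hexp : Real.exp (min ((a * r) ^ 2) (a * r) / 4) ≤ Real.exp (G.divergence θ θ') := by
    calc _ ≤ Real.exp (a * r) - a * r := exp_min_sq_self_div_four_le hr
      _ ≤ _ := monotoneOn_exp_sub_self hr (hr.trans (hcoercive _)) (hcoercive (θ' - θ))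
      _ ≤ _ := exp_integral_max_zero_sub_le (hT.const_inner _)
        (G.integrable_exp_inner_sub_law θ _ hθ')
      _ = _ := by rw [hmean, sub_zero, G.exp_divergence θ hθ']
  calc min (a ^ 2) a / 4 * min (r ^ 2) r = min (a ^ 2) a * min (r ^ 2) r / 4 := by ring
    _ ≤ min ((a * r) ^ 2) (a * r) / 4 := by
      rw [mul_pow]
      gcongr
      refine le_min ?_ ?_ <;> gcongr <;> simp
    _ ≤ _ := Real.exp_le_exp.1 hexp

theorem divergence_pos (hG : G.IsFullRank) (hθ : θ ∈ interior G.naturalSpace)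
    (hθ' : θ' ∈ G.naturalSpace) (hne : θ' ≠ θ) : 0 < G.divergence θ θ' := by
  obtain ⟨c, hc, hle⟩ := exists_le_divergence hG hθ
  have : 0 < ‖θ' - θ‖ := norm_pos_iff.2 (sub_ne_zero.2 hne)
  exact lt_of_lt_of_le (by positivity) (hle θ' hθ')

theorem injOn_mean (hG : G.IsFullRank) : Set.InjOn G.mean (interior G.naturalSpace) := by
  intro θ hθ θ' hθ' h
  by_contra hne
  have hpos := divergence_pos hG hθ (interior_subset hθ') (Ne.symm hne)
  have hpos' := divergence_pos hG hθ' (interior_subset hθ) hne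
  rw [divergence] at hpos hpos'
  rw [← h, ← neg_sub θ' θ, inner_neg_right] at hpos'
  linarith

theorem exists_mul_norm_sub_le_logPartition_sub_inner (hθ : θ ∈ interior G.naturalSpace)
    {p : EuclideanSpace ℝ (Fin d)} (hp : p ∈ interior (convexSupport ((G.law θ).map G.T))) :
    ∃ c > 0, ∃ C, ∀ θ' ∈ G.naturalSpace,
      c * ‖θ' - θ‖ - C ≤ G.logPartition θ' - inner ℝ p θ' := by
  have := G.isProbabilityMeasure_law (interior_subset hθ)
  obtain ⟨a, ha, hcoercive⟩ := exists_mul_norm_le_integral_max_inner_zero (integrable_T_sub hθ p)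
    fun u hu => not_ae_inner_sub_nonpos_of_mem_interior_convexSupport
      G.measurable_T.aemeasurable hp hu
  set b := ‖G.mean θ - p‖
  refine ⟨a, ha, Real.log 2 + b * (Real.log 2 / a) - G.logPartition θ + inner ℝ p θ,
    fun θ' hθ' => ?_⟩
  set r := ‖θ' - θ‖
  set t := G.logPartition θ' - G.logPartition θ - inner ℝ p (θ' - θ) with ht
  suffices a * r ≤ t + (Real.log 2 + b * (Real.log 2 / a)) by
    rw [ht, inner_sub_right] at this
    linarith
  have hexp : Real.exp (a * r) ≤ Real.exp t + 1 := by
    rw [ht, ← G.integral_exp_inner_sub_law θ p hθ']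
    exact (Real.exp_le_exp.2 (hcoercive _)).trans <| exp_integral_max_zero_le_integral_exp_add_one
      ((integrable_T_sub hθ p).const_inner _) (G.integrable_exp_inner_sub_law θ p hθ')
  rcases le_total (a * r) (Real.log 2) with hsmall | hlarge
  · have hr : b * r ≤ b * (Real.log 2 / a) := by
      gcongr
      rwa [le_div_iff₀' ha]
    have ht_ge : -(b * r) ≤ t := by
      linarith [inner_mean_sub_le hθ hθ' p, neg_abs_le (inner ℝ (θ' - θ) (G.mean θ - p)),
        abs_real_inner_le_norm (θ' - θ) (G.mean θ - p), mul_comm b r]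
    linarith
  · have htwo : 2 ≤ Real.exp (a * r) := by
      rwa [Real.log_le_iff_le_exp two_pos] at hlarge
    have : Real.exp (a * r) ≤ Real.exp (t + Real.log 2) := by
      rw [Real.exp_add, Real.exp_log two_pos]
      linarith
    linarith [Real.exp_le_exp.1 this, show 0 ≤ b * (Real.log 2 / a) by positivity]

end Interior

end ExpFamily

/-! ### Asymptotics of conjugate masses -/

theorem integral_exp_neg_mul_norm_sub {E : Type*} [NormedAddCommGroup E] [NormedSpace ℝ E]
    [FiniteDimensional ℝ E] [MeasurableSpace E] [BorelSpace E] (μ : Measure E)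
    [μ.IsAddHaarMeasure] {c : ℝ} (hc : 0 < c) (y : E) :
    ∫ x, Real.exp (-(c * ‖x - y‖)) ∂μ =
      (c ^ Module.finrank ℝ E)⁻¹ * ∫ x, Real.exp (-‖x‖) ∂μ := by
  calc ∫ x, Real.exp (-(c * ‖x - y‖)) ∂μ
      = ∫ x, Real.exp (-‖c • x‖) ∂μ := by
        rw [integral_sub_right_eq_self (fun x => Real.exp (-(c * ‖x‖))) y]
        simp only [norm_smul, Real.norm_of_nonneg hc.le]
    _ = _ := by
        rw [Measure.integral_comp_smul μ fun x => Real.exp (-‖x‖),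
          abs_of_nonneg (by positivity), smul_eq_mul]

theorem mul_sub_sq_le_mul_min {L n t : ℝ} (hn : L ≤ √n) (hn₀ : 0 ≤ n)
    (ht : 0 ≤ t) : L * (√n * t) - L ^ 2 ≤ n * min (t ^ 2) t := by
  have hx : 0 ≤ √n * t := by positivity
  have hquad : n * t ^ 2 = (√n * t) ^ 2 := by rw [mul_pow, Real.sq_sqrt hn₀]
  have hlin : n * t = √n * (√n * t) := by rw [← mul_assoc, Real.mul_self_sqrt hn₀]
  rw [mul_min_of_nonneg _ _ hn₀, hquad, hlin]
  refine le_min ?_ ?_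
  · nlinarith [sq_nonneg (√n * t - L), sq_nonneg (√n * t), sq_nonneg L]
  · nlinarith [mul_nonneg hx (sub_nonneg.2 hn), sq_nonneg L]

namespace ExpFamily

variable {𝒳 : Type*} [MeasurableSpace 𝒳] {d : ℕ} (G : ExpFamily 𝒳 d)

/-- The exponent of the unnormalized conjugate prior with hyperparameters `τ`, `m`. The
log-likelihood of `n` observations whose statistics add up to `s` is, up to a summand free of `θ`,
the exponent with hyperparameters `s`, `n`. -/
noncomputable def conjugateExponent (τ : EuclideanSpace ℝ (Fin d)) (m : ℝ)
    (θ : EuclideanSpace ℝ (Fin d)) : ℝ :=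
  inner ℝ τ θ - m * G.logPartition θ

/-- The total mass of the unnormalized conjugate prior with hyperparameters `τ`, `m`: the
reciprocal of `priorConst`. -/
noncomputable def conjugateMass (τ : EuclideanSpace ℝ (Fin d)) (m : ℝ) : ℝ :=
  ∫ θ in G.naturalSpace, Real.exp (G.conjugateExponent τ m θ)

theorem conjugateExponent_add (τ s : EuclideanSpace ℝ (Fin d)) (m n : ℝ)
    (θ : EuclideanSpace ℝ (Fin d)) :
    G.conjugateExponent (τ + s) (m + n) θ =
      G.conjugateExponent τ m θ + G.conjugateExponent s n θ := by
  simp only [conjugateExponent, inner_add_left]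
  ring

theorem conjugateExponent_eq_sub_divergence (s : EuclideanSpace ℝ (Fin d)) (n : ℝ)
    (θ θ' : EuclideanSpace ℝ (Fin d)) :
    G.conjugateExponent s n θ' = G.conjugateExponent s n θ
      + (inner ℝ (s - n • G.mean θ) (θ' - θ) - n * G.divergence θ θ') := by
  simp only [conjugateExponent, divergence, inner_sub_left, inner_sub_right, real_inner_smul_left]
  ring

theorem likelihood_eq (n : ℕ) (x : ℕ → 𝒳) (θ : EuclideanSpace ℝ (Fin d)) :
    G.likelihood n x θ = (∏ i ∈ Finset.range n, G.h (x i)) *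
      Real.exp (G.conjugateExponent (∑ i ∈ Finset.range n, G.T (x i)) n θ) := by
  simp only [likelihood, density, conjugateExponent, Finset.prod_mul_distrib, ← Real.exp_sum,
    Finset.sum_sub_distrib, sum_inner, real_inner_comm, Finset.sum_const, Finset.card_range,
    nsmul_eq_mul]

theorem evidence_eq (τ : EuclideanSpace ℝ (Fin d)) (m : ℝ) (n : ℕ) (x : ℕ → 𝒳) :
    G.evidence τ m n x = (∏ i ∈ Finset.range n, G.h (x i)) * (G.conjugateMass τ m)⁻¹ *
      G.conjugateMass (τ + ∑ i ∈ Finset.range n, G.T (x i)) (m + n) := by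
  rw [evidence, conjugateMass.eq_def G (τ + _), ← integral_const_mul]
  refine integral_congr_ae (ae_of_all _ fun θ => ?_)
  change G.likelihood n x θ * ((G.conjugateMass τ m)⁻¹ * Real.exp (G.conjugateExponent τ m θ)) = _
  simp only [likelihood_eq, conjugateExponent_add, Real.exp_add]
  ring

theorem aestronglyMeasurable_exp_conjugateExponent (τ : EuclideanSpace ℝ (Fin d)) (m : ℝ) :
    AEStronglyMeasurable (fun θ => Real.exp (G.conjugateExponent τ m θ))
      (volume.restrict G.naturalSpace) := by
  have hcont : ContinuousOn (fun θ => Real.exp (G.conjugateExponent τ m θ))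
      (interior G.naturalSpace) := by
    have := G.continuousOn_logPartition
    unfold conjugateExponent
    fun_prop
  rw [← restrict_interior_naturalSpace]
  exact hcont.aestronglyMeasurable isOpen_interior.measurableSet

variable {G} {θ τ : EuclideanSpace ℝ (Fin d)} {m c C r : ℝ}

theorem integrableOn_exp_conjugateExponent (hc : 0 < c)
    (h : ∀ θ' ∈ G.naturalSpace, G.conjugateExponent τ m θ' ≤ C - c * ‖θ' - θ‖) :
    IntegrableOn (fun θ' => Real.exp (G.conjugateExponent τ m θ')) G.naturalSpace := by
  have hdom : Integrable fun θ' => Real.exp C * Real.exp (-(c * ‖θ' - θ‖)) :=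
    ((integrable_exp_neg_mul_norm volume hc).comp_sub_right θ).const_mul _
  refine hdom.integrableOn.mono' (G.aestronglyMeasurable_exp_conjugateExponent τ m) ?_
  filter_upwards [ae_restrict_mem₀ (G.convex_naturalSpace.nullMeasurableSet volume)] with θ' hθ'
  rw [Real.norm_of_nonneg (Real.exp_pos _).le, ← Real.exp_add, Real.exp_le_exp, ← sub_eq_add_neg]
  exact h θ' hθ'

theorem conjugateMass_pos (hθ : θ ∈ interior G.naturalSpace)
    (hint : IntegrableOn (fun θ' => Real.exp (G.conjugateExponent τ m θ')) G.naturalSpace) :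
    0 < G.conjugateMass τ m := by
  have : NeZero (volume.restrict G.naturalSpace) := by
    rw [← restrict_interior_naturalSpace]
    exact ⟨Measure.restrict_eq_zero.not.2 (isOpen_interior.measure_pos _ ⟨θ, hθ⟩).ne'⟩
  exact integral_exp_pos hint

theorem conjugateMass_le (hc : 0 < c)
    (h : ∀ θ' ∈ G.naturalSpace, G.conjugateExponent τ m θ' ≤ C - c * ‖θ' - θ‖) :
    G.conjugateMass τ m ≤ Real.exp C *
      ((c ^ d)⁻¹ * ∫ v : EuclideanSpace ℝ (Fin d), Real.exp (-‖v‖)) := by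
  have hdom : Integrable fun θ' => Real.exp C * Real.exp (-(c * ‖θ' - θ‖)) :=
    ((integrable_exp_neg_mul_norm volume hc).comp_sub_right θ).const_mul _
  calc G.conjugateMass τ m
      ≤ ∫ θ' in G.naturalSpace, Real.exp C * Real.exp (-(c * ‖θ' - θ‖)) := by
        refine setIntegral_mono_on₀ (integrableOn_exp_conjugateExponent hc h) hdom.integrableOn
          (G.convex_naturalSpace.nullMeasurableSet volume) fun θ' hθ' => ?_
        rw [← Real.exp_add, Real.exp_le_exp, ← sub_eq_add_neg]
        exact h θ' hθ'
    _ ≤ ∫ θ', Real.exp C * Real.exp (-(c * ‖θ' - θ‖)) :=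
        setIntegral_le_integral hdom (ae_of_all _ fun θ' => by positivity)
    _ = _ := by rw [integral_const_mul, integral_exp_neg_mul_norm_sub volume hc,
          finrank_euclideanSpace_fin]

theorem le_conjugateMass (hr : 0 ≤ r)
    (hint : IntegrableOn (fun θ' => Real.exp (G.conjugateExponent τ m θ')) G.naturalSpace)
    (h : ∀ θ' ∈ Metric.closedBall θ r,
      θ' ∈ G.naturalSpace ∧ C ≤ G.conjugateExponent τ m θ') :
    Real.exp C * (r ^ d * volume.real (Metric.ball (0 : EuclideanSpace ℝ (Fin d)) 1))
      ≤ G.conjugateMass τ m := by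
  have hsub : Metric.closedBall θ r ⊆ G.naturalSpace := fun θ' hθ' => (h θ' hθ').1
  calc _ = ∫ _ in Metric.closedBall θ r, Real.exp C := by
        rw [setIntegral_const, Measure.addHaar_real_closedBall _ _ hr, finrank_euclideanSpace,
          Fintype.card_fin, smul_eq_mul, mul_comm]
    _ ≤ ∫ θ' in Metric.closedBall θ r, Real.exp (G.conjugateExponent τ m θ') :=
        setIntegral_mono_on (integrableOn_const measure_closedBall_lt_top.ne)
          (hint.mono_set hsub) measurableSet_closedBall
          fun θ' hθ' => Real.exp_le_exp.2 (h θ' hθ').2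
    _ ≤ _ := setIntegral_mono_set hint (ae_of_all _ fun _ => (Real.exp_pos _).le)
        hsub.eventuallyLE

theorem exists_conjugateExponent_le (hθ : θ ∈ interior G.naturalSpace) (hm : 0 < m)
    (hτ : m⁻¹ • τ ∈ interior (convexSupport ((G.law θ).map G.T))) :
    ∃ c > 0, ∃ C, ∀ θ' ∈ G.naturalSpace, G.conjugateExponent τ m θ' ≤ C - c * ‖θ' - θ‖ := by
  obtain ⟨c, hc, C, h⟩ := exists_mul_norm_sub_le_logPartition_sub_inner hθ hτ
  refine ⟨m * c, by positivity, m * C, fun θ' hθ' => ?_⟩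
  have hmul := mul_le_mul_of_nonneg_left (h θ' hθ') hm.le
  rw [real_inner_smul_left, mul_sub, mul_sub, mul_inv_cancel_left₀ hm.ne'] at hmul
  rw [conjugateExponent]
  linarith

theorem conjugateMass_prior_pos (hθ : θ ∈ interior G.naturalSpace) (hm : 0 < m)
    (hτ : m⁻¹ • τ ∈ interior (convexSupport ((G.law θ).map G.T))) :
    0 < G.conjugateMass τ m := by
  obtain ⟨c, hc, C, h⟩ := exists_conjugateExponent_le hθ hm hτ
  exact conjugateMass_pos hθ (integrableOn_exp_conjugateExponent hc h)

theorem exists_posterior_exponent_le (hG : G.IsFullRank) (hθ : θ ∈ interior G.naturalSpace)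
    (hm : 0 < m) (hτ : m⁻¹ • τ ∈ interior (convexSupport ((G.law θ).map G.T))) (R : ℝ) :
    ∃ C, ∀ᶠ n : ℕ in atTop, ∀ s, ‖s - (n : ℝ) • G.mean θ‖ ≤ R * √n → ∀ θ' ∈ G.naturalSpace,
      G.conjugateExponent (τ + s) (m + n) θ'
        ≤ G.conjugateExponent s n θ + C - R * √n * ‖θ' - θ‖ := by
  obtain ⟨b, hb, B, hprior⟩ := exists_conjugateExponent_le hθ hm hτ
  obtain ⟨c, hc, hD⟩ := exists_le_divergence hG hθ
  -- Since `c * L = 2 * R`, half of the divergence bound absorbs the linear term and half remains.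
  set L : ℝ := 2 * R / c
  have hcL : c * L = 2 * R := mul_div_cancel₀ _ hc.ne'
  refine ⟨c * L ^ 2 + B, ?_⟩
  filter_upwards [tendsto_natCast_atTop_atTop.eventually_ge_atTop (L ^ 2)]
    with n hn s hs θ' hθ'
  have hlinear : inner ℝ (s - (n : ℝ) • G.mean θ) (θ' - θ) ≤ R * √n * ‖θ' - θ‖ :=
    (real_inner_le_norm _ _).trans (by gcongr)
  have hmin := mul_sub_sq_le_mul_min (Real.le_sqrt_of_sq_le hn) n.cast_nonneg
    (norm_nonneg (θ' - θ))
  have hdiv : 2 * R * √n * ‖θ' - θ‖ - c * L ^ 2 ≤ n * G.divergence θ θ' :=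
    calc 2 * R * √n * ‖θ' - θ‖ - c * L ^ 2 = c * (L * (√n * ‖θ' - θ‖) - L ^ 2) := by
          rw [← hcL]; ring
      _ ≤ c * (n * min (‖θ' - θ‖ ^ 2) ‖θ' - θ‖) := by gcongr
      _ = n * (c * min (‖θ' - θ‖ ^ 2) ‖θ' - θ‖) := by ring
      _ ≤ n * G.divergence θ θ' := by gcongr; exact hD θ' hθ'
  have hb' : 0 ≤ b * ‖θ' - θ‖ := by positivity
  rw [conjugateExponent_add, conjugateExponent_eq_sub_divergence G s n θ θ']
  linarith [hprior θ' hθ']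

theorem exists_le_posterior_exponent (hθ : θ ∈ interior G.naturalSpace)
    (τ : EuclideanSpace ℝ (Fin d)) (m R : ℝ) :
    ∃ C, ∀ᶠ n : ℕ in atTop, ∀ s, ‖s - (n : ℝ) • G.mean θ‖ ≤ R * √n →
      ∀ θ' ∈ Metric.closedBall θ (√n)⁻¹, θ' ∈ G.naturalSpace ∧
        G.conjugateExponent s n θ + C ≤ G.conjugateExponent (τ + s) (m + n) θ' := by
  obtain ⟨K, hK, hD⟩ := exists_divergence_le hθ
  have hcont : ContinuousAt (G.conjugateExponent τ m) θ := by
    have := (hasGradientAt_logPartition hθ).continuousAt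
    unfold conjugateExponent
    fun_prop
  obtain ⟨δ, hδ, hball⟩ := Metric.eventually_nhds_iff_ball.1
    (Filter.Eventually.and (mem_interior_iff_mem_nhds.1 hθ) (hD.and <|
      hcont.eventually (lt_mem_nhds (sub_one_lt _))))
  have hlim : Tendsto (fun n : ℕ => (√(n : ℝ))⁻¹) atTop (𝓝 0) :=
    tendsto_inv_atTop_zero.comp (Real.tendsto_sqrt_atTop.comp tendsto_natCast_atTop_atTop)
  refine ⟨G.conjugateExponent τ m θ - 1 - R - K, ?_⟩
  filter_upwards [hlim.eventually_lt_const hδ, eventually_gt_atTop 0] with n hn hn₀ s hs θ' hθ'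
  have hsqrt : 0 < √(n : ℝ) := Real.sqrt_pos.2 (Nat.cast_pos.2 hn₀)
  have hdist := mem_closedBall_iff_norm.1 hθ'
  obtain ⟨hmem, hdiv, hprior⟩ := hball θ' (Metric.closedBall_subset_ball hn hθ')
  have hlinear : |inner ℝ (s - (n : ℝ) • G.mean θ) (θ' - θ)| ≤ R :=
    calc _ ≤ ‖s - (n : ℝ) • G.mean θ‖ * ‖θ' - θ‖ := abs_real_inner_le_norm _ _
      _ ≤ R * √n * (√n)⁻¹ := by gcongr; exact (norm_nonneg _).trans hs
      _ = R := mul_inv_cancel_right₀ hsqrt.ne' R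
  have hquad : n * G.divergence θ θ' ≤ K :=
    calc n * G.divergence θ θ' ≤ n * (K * (√(n : ℝ))⁻¹ ^ 2) := by
          gcongr
          exact hdiv.trans (by gcongr)
      _ = K := by rw [inv_pow, Real.sq_sqrt n.cast_nonneg]; field_simp
  refine ⟨hmem, ?_⟩
  rw [conjugateExponent_add, conjugateExponent_eq_sub_divergence G s n θ θ']
  linarith [neg_le_of_abs_le hlinear]

theorem exists_abs_log_conjugateMass_sub_le (hG : G.IsFullRank)
    (hθ : θ ∈ interior G.naturalSpace) (hm : 0 < m)
    (hτ : m⁻¹ • τ ∈ interior (convexSupport ((G.law θ).map G.T)))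
    {R : ℝ} (hR : 0 < R) :
    ∃ C, ∀ᶠ n : ℕ in atTop, ∀ s, ‖s - (n : ℝ) • G.mean θ‖ ≤ R * √n →
      0 < G.conjugateMass (τ + s) (m + n) ∧
      |Real.log (G.conjugateMass (τ + s) (m + n))
        - (G.conjugateExponent s n θ - d / 2 * Real.log n)| ≤ C := by
  obtain ⟨C₁, hupper⟩ := exists_posterior_exponent_le hG hθ hm hτ R
  obtain ⟨C₂, hlower⟩ := exists_le_posterior_exponent hθ τ m R
  set I : ℝ := ∫ v : EuclideanSpace ℝ (Fin d), Real.exp (-‖v‖)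
  have hI : 0 < I := integral_exp_pos (by simpa using integrable_exp_neg_mul_norm volume one_pos)
  set V : ℝ := volume.real (Metric.ball (0 : EuclideanSpace ℝ (Fin d)) 1)
  have hV : 0 < V := ENNReal.toReal_pos (Metric.measure_ball_pos _ _ one_pos).ne'
    measure_ball_lt_top.ne
  refine ⟨max |C₁ - d * Real.log R + Real.log I| |C₂ + Real.log V|, ?_⟩
  filter_upwards [hupper, hlower, eventually_gt_atTop 0] with n hupper hlower hn₀ s hs
  have hn : (0 : ℝ) < n := Nat.cast_pos.2 hn₀
  have hlog : Real.log √n = Real.log n / 2 := Real.log_sqrt hn.le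
  have hint := integrableOn_exp_conjugateExponent (by positivity) (hupper s hs)
  have hpos := conjugateMass_pos hθ hint
  have hlog_le := Real.log_le_log hpos (conjugateMass_le (by positivity) (hupper s hs))
  have hle_log := Real.log_le_log (by positivity)
    (le_conjugateMass (by positivity) hint (hlower s hs))
  rw [Real.log_mul (by positivity) (by positivity), Real.log_mul (by positivity) hI.ne',
    Real.log_exp, Real.log_inv, Real.log_pow, Real.log_mul hR.ne' (by positivity), hlog] at hlog_le
  rw [Real.log_mul (by positivity) (by positivity), Real.log_mul (by positivity) hV.ne',
    Real.log_exp, Real.log_pow, Real.log_inv, hlog] at hle_log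
  refine ⟨hpos, abs_le.2 ⟨?_, ?_⟩⟩
  · linarith [le_max_right |C₁ - d * Real.log R + Real.log I| |C₂ + Real.log V|,
      neg_abs_le (C₂ + Real.log V)]
  · linarith [le_max_left |C₁ - d * Real.log R + Real.log I| |C₂ + Real.log V|,
      le_abs_self (C₁ - d * Real.log R + Real.log I)]

end ExpFamily

/-! ### Stochastic boundedness -/

/-- Stochastic boundedness of a sequence of random elements, `f n = O_P(1)` as `n → ∞`. Only a tail
of the sequence is controlled, so single unbounded terms are harmless. -/
def BoundedInProbability {Ω E : Type*} [MeasurableSpace Ω] [Norm E] (P : Measure Ω)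
    (f : ℕ → Ω → E) : Prop :=
  ∀ ε > 0, ∃ C : ℝ, ∀ᶠ n in atTop, P {ω | C < ‖f n ω‖} ≤ ε

namespace BoundedInProbability

variable {Ω E E' : Type*} [MeasurableSpace Ω] {P : Measure Ω}

theorem of_forall_bound [Norm E] [Norm E'] {f : ℕ → Ω → E} {g : ℕ → Ω → E'}
    (hg : BoundedInProbability P g)
    (h : ∀ R > 0, ∃ C, ∀ᶠ n in atTop, ∀ᵐ ω ∂P, ‖g n ω‖ ≤ R → ‖f n ω‖ ≤ C) :
    BoundedInProbability P f := by
  intro ε hε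
  obtain ⟨R, hR⟩ := hg ε hε
  obtain ⟨C, hC⟩ := h (max R 1) (lt_max_of_lt_right one_pos)
  refine ⟨C, ?_⟩
  filter_upwards [hR, hC] with n hRn hCn
  refine (measure_mono_ae ?_).trans hRn
  filter_upwards [hCn] with ω hω hfω
  exact (le_max_left _ _).trans_lt (not_le.1 fun hgω => hfω.not_ge (hω hgω))

theorem tendstoInMeasure [NormedAddCommGroup E] [NormedAddCommGroup E'] {f : ℕ → Ω → E}
    {g : ℕ → Ω → E'} {c : E'} {r : ℕ → ℝ} (hf : BoundedInProbability P f)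
    (hr : Tendsto r atTop (𝓝 0)) (h : ∀ᶠ n in atTop, ∀ ω, ‖g n ω - c‖ ≤ r n * ‖f n ω‖) :
    TendstoInMeasure P g atTop fun _ => c := by
  rw [tendstoInMeasure_iff_norm]
  refine fun δ hδ => ENNReal.tendsto_nhds_zero.2 fun ε hε => ?_
  obtain ⟨C, hC⟩ := hf ε hε
  have hrC : Tendsto (fun n => |r n| * C) atTop (𝓝 0) := by simpa using hr.abs.mul_const C
  filter_upwards [hC, h, hrC.eventually_lt_const hδ] with n hCn hn hδn
  refine le_trans (measure_mono fun ω hω => Set.mem_ofPred.2 (not_le.1 fun hfω => ?_)) hCn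
  refine hδn.not_ge (hω.trans ?_)
  calc ‖g n ω - c‖ ≤ r n * ‖f n ω‖ := hn ω
    _ ≤ |r n| * C := by gcongr; exact le_abs_self _

theorem of_integral_norm_sq_le [NormedAddCommGroup E] {f : ℕ → Ω → E} {V : ℝ}
    (hint : ∀ n, Integrable (fun ω => ‖f n ω‖ ^ 2) P) (hV : ∀ n, ∫ ω, ‖f n ω‖ ^ 2 ∂P ≤ V) :
    BoundedInProbability P f := by
  intro ε hε
  have hlim : Tendsto (fun C : ℝ => ENNReal.ofReal (V / C ^ 2)) atTop (𝓝 0) := by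
    simpa using
      ENNReal.tendsto_ofReal (tendsto_const_nhds.div_atTop (tendsto_pow_atTop two_ne_zero))
  obtain ⟨C, hCε, hC⟩ := ((hlim.eventually_le_const hε).and (eventually_gt_atTop 0)).exists
  refine ⟨C, Eventually.of_forall fun n => ?_⟩
  have hC2 : 0 < C ^ 2 := by positivity
  calc P {ω | C < ‖f n ω‖}
      ≤ P {ω | ENNReal.ofReal (C ^ 2) ≤ ENNReal.ofReal (‖f n ω‖ ^ 2)} :=
        measure_mono fun ω hω => ENNReal.ofReal_le_ofReal
          (pow_le_pow_left₀ hC.le (Set.mem_ofPred.1 hω).le 2)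
    _ ≤ (∫⁻ ω, ENNReal.ofReal (‖f n ω‖ ^ 2) ∂P) / ENNReal.ofReal (C ^ 2) :=
        meas_ge_le_lintegral_div (hint n).aemeasurable.ennreal_ofReal
          (ENNReal.ofReal_pos.2 hC2).ne' ENNReal.ofReal_ne_top
    _ ≤ ENNReal.ofReal (V / C ^ 2) := by
        rw [← ofReal_integral_eq_lintegral_ofReal (hint n) (ae_of_all _ fun ω => sq_nonneg _),
          ← ENNReal.ofReal_div_of_pos hC2]
        gcongr
        exact hV n
    _ ≤ ε := hCε

end BoundedInProbability

section Uncorrelated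

variable {Ω E : Type*} [MeasurableSpace Ω] {P : Measure Ω} [IsFiniteMeasure P]
  [NormedAddCommGroup E] [InnerProductSpace ℝ E] [CompleteSpace E] [MeasurableSpace E]
  [BorelSpace E]

theorem integral_norm_sum_sq_of_pairwise_indepFun {ι : Type*} {Y : ι → Ω → E}
    (hY : ∀ i, MemLp (Y i) 2 P) (hmean : ∀ i, ∫ ω, Y i ω ∂P = 0)
    (hindep : Pairwise fun i j => IndepFun (Y i) (Y j) P) (s : Finset ι) :
    ∫ ω, ‖∑ i ∈ s, Y i ω‖ ^ 2 ∂P = ∑ i ∈ s, ∫ ω, ‖Y i ω‖ ^ 2 ∂P := by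
  have hint : ∀ i, Integrable (Y i) P := fun i => (hY i).integrable one_le_two
  have hinner : ∀ i j, Integrable (fun ω => inner ℝ (Y i ω) (Y j ω)) P := fun i j => by
    rcases eq_or_ne i j with rfl | hij
    · simpa only [real_inner_self_eq_norm_sq] using (hY i).integrable_norm_pow two_ne_zero
    · exact (hindep hij).integrable_bilin (hint i) (hint j) (innerSL ℝ)
  have horth : ∀ i j, i ≠ j → ∫ ω, inner ℝ (Y i ω) (Y j ω) ∂P = 0 := fun i j hij => by
    refine ((hindep hij).integral_bilin (hint i) (hint j) (innerSL ℝ)).trans ?_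
    rw [hmean i, map_zero, zero_apply]
  calc ∫ ω, ‖∑ i ∈ s, Y i ω‖ ^ 2 ∂P
      = ∑ i ∈ s, ∑ j ∈ s, ∫ ω, inner ℝ (Y j ω) (Y i ω) ∂P := by
        simp only [← real_inner_self_eq_norm_sq, sum_inner, inner_sum]
        rw [integral_finsetSum _ fun i _ => integrable_finsetSum _ fun j _ => hinner _ _]
        exact Finset.sum_congr rfl fun i _ => integral_finsetSum _ fun j _ => hinner _ _
    _ = ∑ i ∈ s, ∫ ω, ‖Y i ω‖ ^ 2 ∂P := by
        refine Finset.sum_congr rfl fun i hi => ?_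
        rw [Finset.sum_eq_single_of_mem i hi fun j _ hji => horth j i hji]
        simp only [real_inner_self_eq_norm_sq]

theorem boundedInProbability_inv_sqrt_smul_sum {Y : ℕ → Ω → E} {V : ℝ}
    (hY : ∀ i, MemLp (Y i) 2 P) (hmean : ∀ i, ∫ ω, Y i ω ∂P = 0)
    (hV : ∀ i, ∫ ω, ‖Y i ω‖ ^ 2 ∂P ≤ V)
    (hindep : Pairwise fun i j => IndepFun (Y i) (Y j) P) :
    BoundedInProbability P fun n ω => (√(n : ℝ))⁻¹ • ∑ i ∈ Finset.range n, Y i ω := by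
  have hnorm : ∀ (n : ℕ) ω, ‖(√(n : ℝ))⁻¹ • ∑ i ∈ Finset.range n, Y i ω‖ ^ 2
      = (n : ℝ)⁻¹ * ‖∑ i ∈ Finset.range n, Y i ω‖ ^ 2 := fun n ω => by
    rw [norm_smul, mul_pow, norm_inv, Real.norm_of_nonneg (Real.sqrt_nonneg _), inv_pow,
      Real.sq_sqrt n.cast_nonneg]
  have hV₀ : 0 ≤ V := (integral_nonneg fun ω => sq_nonneg _).trans (hV 0)
  refine .of_integral_norm_sq_le (V := V) (fun n => ?_) fun n => ?_
  · exact ((memLp_finsetSum _ fun i _ => hY i).const_smul _).integrable_norm_pow two_ne_zero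
  · simp only [hnorm]
    rw [integral_const_mul, integral_norm_sum_sq_of_pairwise_indepFun hY hmean hindep]
    refine inv_mul_le_of_le_mul₀ n.cast_nonneg hV₀ ?_
    simpa using Finset.sum_le_card_nsmul (Finset.range n) _ V fun i _ => hV i

end Uncorrelated

/-! ### Minimizing the divergence over a nested model -/

theorem isClosed_setOf_lintegral_le {X Y : Type*} [MeasurableSpace X] [TopologicalSpace Y]
    [SequentialSpace Y] {μ : Measure X} {f : Y → X → ℝ≥0∞} (hmeas : ∀ y, Measurable (f y))
    (hcont : ∀ x, Continuous fun y => f y x) (c : ℝ≥0∞) :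
    IsClosed {y | ∫⁻ x, f y x ∂μ ≤ c} := by
  refine IsSeqClosed.isClosed fun u y hu hlim => Set.mem_ofPred.2 ?_
  have hliminf (x : X) : liminf (fun j => f (u j) x) atTop = f y x :=
    (((hcont x).tendsto y).comp hlim).liminf_eq
  calc ∫⁻ x, f y x ∂μ = ∫⁻ x, liminf (fun j => f (u j) x) atTop ∂μ := by simp only [hliminf]
    _ ≤ liminf (fun j => ∫⁻ x, f (u j) x ∂μ) atTop := lintegral_liminf_le fun j => hmeas (u j)
    _ ≤ c := liminf_le_of_frequently_le' (Frequently.of_forall hu)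

namespace ExpFamily

section Projection

variable {𝒳 : Type*} [MeasurableSpace 𝒳] {d : ℕ} {G : ExpFamily 𝒳 d}
  {θ θ' : EuclideanSpace ℝ (Fin d)}

theorem mem_naturalSpace_and_divergence_le_iff (hθ : θ ∈ G.naturalSpace) {b : ℝ} :
    θ' ∈ G.naturalSpace ∧ G.divergence θ θ' ≤ b ↔
      ∫⁻ x, ENNReal.ofReal (Real.exp (inner ℝ (θ' - θ) (G.T x - G.mean θ))) ∂(G.law θ)
        ≤ ENNReal.ofReal (Real.exp b) := by
  have hnonneg : 0 ≤ᵐ[G.law θ] fun x => Real.exp (inner ℝ (θ' - θ) (G.T x - G.mean θ)) :=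
    ae_of_all _ fun x => (Real.exp_pos _).le
  have hle (hθ' : θ' ∈ G.naturalSpace) : G.divergence θ θ' ≤ b ↔
      ∫⁻ x, ENNReal.ofReal (Real.exp (inner ℝ (θ' - θ) (G.T x - G.mean θ))) ∂(G.law θ)
        ≤ ENNReal.ofReal (Real.exp b) := by
    rw [← ofReal_integral_eq_lintegral_ofReal (G.integrable_exp_inner_sub_law θ _ hθ') hnonneg,
      ← G.exp_divergence θ hθ', ENNReal.ofReal_le_ofReal_iff (Real.exp_pos b).le, Real.exp_le_exp]
  refine ⟨fun h => (hle h.1).1 h.2, fun h => ?_⟩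
  have hθ' : θ' ∈ G.naturalSpace := by
    refine (mem_naturalSpace_iff_integrable_exp_inner_sub hθ (G.mean θ)).2
      ⟨((G.measurable_T.sub_const _).const_inner).exp.aestronglyMeasurable, ?_⟩
    rw [hasFiniteIntegral_iff_ofReal hnonneg]
    exact h.trans_lt ENNReal.ofReal_lt_top
  exact ⟨hθ', (hle hθ').2 h⟩

theorem isClosed_divergence_le (hθ : θ ∈ G.naturalSpace) (b : ℝ) :
    IsClosed {θ' ∈ G.naturalSpace | G.divergence θ θ' ≤ b} := by
  simp only [mem_naturalSpace_and_divergence_le_iff hθ]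
  exact isClosed_setOf_lintegral_le
    (fun _ => ((G.measurable_T.sub_const _).const_inner).exp.ennreal_ofReal)
    (fun _ => ENNReal.continuous_ofReal.comp (by fun_prop)) _

theorem isCompact_divergence_le (hG : G.IsFullRank) (hθ : θ ∈ interior G.naturalSpace) (b : ℝ) :
    IsCompact {θ' ∈ G.naturalSpace | G.divergence θ θ' ≤ b} := by
  refine Metric.isCompact_of_isClosed_isBounded
    (isClosed_divergence_le (interior_subset hθ) b) ?_
  obtain ⟨c, hc, hD⟩ := exists_le_divergence hG hθ
  refine (Metric.isBounded_closedBall (x := θ) (r := max 1 (b / c))).subset fun θ' hθ' => ?_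
  rw [mem_closedBall_iff_norm, le_max_iff, or_iff_not_imp_left, le_div_iff₀ hc, mul_comm]
  intro hfar
  calc c * ‖θ' - θ‖ = c * min (‖θ' - θ‖ ^ 2) ‖θ' - θ‖ := by
        rw [min_eq_right (le_self_pow₀ (not_le.1 hfar).le two_ne_zero)]
    _ ≤ G.divergence θ θ' := hD θ' hθ'.1
    _ ≤ b := hθ'.2

theorem exists_isMinOn_divergence (hG : G.IsFullRank) (hθ : θ ∈ interior G.naturalSpace)
    {S : Set (EuclideanSpace ℝ (Fin d))} (hS : IsClosed S) (hne : (S ∩ G.naturalSpace).Nonempty) :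
    ∃ θ' ∈ S ∩ G.naturalSpace, IsMinOn (G.divergence θ) (S ∩ G.naturalSpace) θ' := by
  obtain ⟨θ₁, hθ₁S, hθ₁⟩ := hne
  set b := G.divergence θ θ₁
  set K := S ∩ {θ' ∈ G.naturalSpace | G.divergence θ θ' ≤ b}
  have hlsc : LowerSemicontinuousOn (G.divergence θ) K := by
    refine lowerSemicontinuousOn_iff_preimage_Iic.2 fun a =>
      ⟨_, isClosed_divergence_le (interior_subset hθ) a, ?_⟩
    ext θ'
    exact and_congr_right fun hθ' => (and_iff_right hθ'.2.1).symm
  obtain ⟨θ', hθ', hmin⟩ := hlsc.exists_isMinOn (s := K) ⟨θ₁, hθ₁S, hθ₁, le_rfl⟩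
    ((isCompact_divergence_le hG hθ b).inter_left hS)
  refine ⟨θ', ⟨hθ'.1, hθ'.2.1⟩, fun θ'' hθ'' => ?_⟩
  rcases le_total (G.divergence θ θ'') b with hle | hge
  · exact hmin ⟨hθ''.1, hθ''.2, hle⟩
  · exact hθ'.2.2.trans hge

end Projection

section Nested

variable {𝒳 : Type*} [MeasurableSpace 𝒳] {k l : ℕ} (F : ExpFamily 𝒳 k)
  (M : Matrix (Fin l) (Fin k) ℝ)

theorem inner_toEuclideanLin_left (t : EuclideanSpace ℝ (Fin k)) (η : EuclideanSpace ℝ (Fin l)) :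
    inner ℝ (M.toEuclideanLin t) η = inner ℝ t (M.transpose.toEuclideanLin η) := by
  rw [← Matrix.conjTranspose_eq_transpose_of_trivial,
    Matrix.toEuclideanLin_conjTranspose_eq_adjoint, LinearMap.adjoint_inner_right]

theorem law_nested (η : EuclideanSpace ℝ (Fin l)) :
    (F.nested M).law η = F.law (M.transpose.toEuclideanLin η) := by
  unfold law
  simp only [density_nested]
  rfl

theorem convexSupport_map_nested_T_subset (θ : EuclideanSpace ℝ (Fin k))
    (η : EuclideanSpace ℝ (Fin l)) :
    convexSupport ((F.law θ).map (F.nested M).T) ⊆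
      convexSupport (((F.nested M).law η).map (F.nested M).T) := by
  rw [law_nested]
  exact convexSupport_subset_of_absolutelyContinuous
    ((F.law_absolutelyContinuous _ _).map (F.nested M).measurable_T)

theorem conjugateExponent_nested (s : EuclideanSpace ℝ (Fin k)) (n : ℝ)
    (η : EuclideanSpace ℝ (Fin l)) :
    (F.nested M).conjugateExponent (M.toEuclideanLin s) n η =
      F.conjugateExponent s n (M.transpose.toEuclideanLin η) := by
  rw [conjugateExponent, conjugateExponent, logPartition_nested, inner_toEuclideanLin_left]

variable {F M}

theorem mean_nested {η : EuclideanSpace ℝ (Fin l)}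
    (hη : M.transpose.toEuclideanLin η ∈ interior F.naturalSpace) :
    (F.nested M).mean η = M.toEuclideanLin (F.mean (M.transpose.toEuclideanLin η)) := by
  rw [mean, law_nested]
  exact (LinearMap.toContinuousLinearMap M.toEuclideanLin).integral_comp_comm
    (by simpa only [sub_zero] using integrable_T_sub hη 0)

theorem injective_toEuclideanLin_transpose (hM : M.rank = l) :
    Function.Injective M.transpose.toEuclideanLin := by
  have hrow : LinearIndependent ℝ M.row := by
    rw [linearIndependent_iff_card_eq_finrank_span, Fintype.card_fin, Set.finrank,
      ← Matrix.rank_eq_finrank_span_row, hM]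
  exact fun η η' h => WithLp.ofLp_injective 2
    (Matrix.mulVec_injective_iff.2 hrow (WithLp.toLp_injective 2 h))

theorem isFullRank_nested (hF : F.IsFullRank) (hM : M.rank = l) : (F.nested M).IsFullRank := by
  intro η hη c b hc
  rw [naturalSpace_nested] at hη
  rw [law_nested] at hc
  simp only [inner_nested_T] at hc
  exact (map_eq_zero_iff _ (injective_toEuclideanLin_transpose hM)).1 (hF _ hη _ b hc)

theorem hasGradientAt_divergence_transpose {η : EuclideanSpace ℝ (Fin l)}
    (hη : η ∈ interior (F.nested M).naturalSpace) (θ : EuclideanSpace ℝ (Fin k)) :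
    HasGradientAt (fun η => F.divergence θ (M.transpose.toEuclideanLin η))
      ((F.nested M).mean η - M.toEuclideanLin (F.mean θ)) η := by
  have hdiv : (fun η => F.divergence θ (M.transpose.toEuclideanLin η)) = fun η =>
      (F.nested M).logPartition η - inner ℝ (M.toEuclideanLin (F.mean θ)) η
        + (inner ℝ (F.mean θ) θ - F.logPartition θ) := by
    funext η
    rw [divergence, logPartition_nested, inner_sub_right, inner_toEuclideanLin_left]
    ring
  rw [hdiv, hasGradientAt_iff_hasFDerivAt, map_sub]
  exact ((hasGradientAt_logPartition hη).hasFDerivAt.sub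
    (InnerProductSpace.toDual ℝ _ (M.toEuclideanLin (F.mean θ))).hasFDerivAt).add_const _

theorem exists_mean_nested_eq (hF : F.IsFullRank) (hE : IsOpen (F.nested M).naturalSpace)
    (hE_ne : (F.nested M).naturalSpace.Nonempty) {θ : EuclideanSpace ℝ (Fin k)}
    (hθ : θ ∈ interior F.naturalSpace) :
    ∃ η ∈ (F.nested M).naturalSpace, (F.nested M).mean η = M.toEuclideanLin (F.mean θ) := by
  have hmem {η : EuclideanSpace ℝ (Fin l)} (hη : η ∈ (F.nested M).naturalSpace) :
      M.transpose.toEuclideanLin η ∈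
        (LinearMap.range M.transpose.toEuclideanLin : Set _) ∩ F.naturalSpace :=
    ⟨⟨η, rfl⟩, by rwa [naturalSpace_nested] at hη⟩
  obtain ⟨η₁, hη₁⟩ := hE_ne
  obtain ⟨_, ⟨⟨η, rfl⟩, hη⟩, hmin⟩ := exists_isMinOn_divergence hF hθ
    (Submodule.closed_of_finiteDimensional (LinearMap.range M.transpose.toEuclideanLin))
    ⟨_, hmem hη₁⟩
  have hηE : η ∈ (F.nested M).naturalSpace := by rwa [naturalSpace_nested]
  have hlocal : IsLocalMin (fun η => F.divergence θ (M.transpose.toEuclideanLin η)) η := by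
    filter_upwards [hE.mem_nhds hηE] with η' hη' using hmin (hmem hη')
  have hzero := hlocal.hasFDerivAt_eq_zero
    (hasGradientAt_divergence_transpose (by rwa [hE.interior_eq]) θ).hasFDerivAt
  exact ⟨η, hηE, sub_eq_zero.1 ((map_eq_zero_iff _ (InnerProductSpace.toDual ℝ _).injective).1
    hzero)⟩

end Nested

end ExpFamily

/-! ### Bayes factors -/

namespace ExpFamily

theorem divergence_eq_inner_sub {𝒳 : Type*} [MeasurableSpace 𝒳] {d : ℕ} (G : ExpFamily 𝒳 d)
    (θ θ' : EuclideanSpace ℝ (Fin d)) :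
    G.divergence θ θ' =
      inner ℝ (θ - θ') (G.mean θ) - (G.logPartition θ - G.logPartition θ') := by
  rw [divergence, ← neg_sub θ, inner_neg_right, real_inner_comm]
  ring

section BayesFactor

variable {𝒳 : Type*} [MeasurableSpace 𝒳] {k l : ℕ} (F : ExpFamily 𝒳 k)
  (M : Matrix (Fin l) (Fin k) ℝ)

/-- The logarithm of the Bayes factor of the full model against the submodel nested by `M`, for the
first `n` observations of the sequence `x` and conjugate priors with hyperparameters `τ`, `m` and
`υ`, `w`. -/
noncomputable def logBayesFactor (τ : EuclideanSpace ℝ (Fin k)) (m : ℝ)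
    (υ : EuclideanSpace ℝ (Fin l)) (w : ℝ) (n : ℕ) (x : ℕ → 𝒳) : ℝ :=
  Real.log (F.evidence τ m n x / (F.nested M).evidence υ w n x)

theorem evidence_div_evidence_nested {τ : EuclideanSpace ℝ (Fin k)} {m : ℝ}
    {υ : EuclideanSpace ℝ (Fin l)} {w : ℝ} {n : ℕ} {x : ℕ → 𝒳} (hx : ∀ i, 0 < F.h (x i)) :
    F.evidence τ m n x / (F.nested M).evidence υ w n x =
      (F.conjugateMass (τ + ∑ i ∈ Finset.range n, F.T (x i)) (m + n) / F.conjugateMass τ m) /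
      ((F.nested M).conjugateMass
        (υ + M.toEuclideanLin (∑ i ∈ Finset.range n, F.T (x i))) (w + n) /
          (F.nested M).conjugateMass υ w) := by
  have hprod : (∏ i ∈ Finset.range n, F.h (x i)) ≠ 0 := (Finset.prod_pos fun i _ => hx i).ne'
  have hsum : ∑ i ∈ Finset.range n, (F.nested M).T (x i) =
      M.toEuclideanLin (∑ i ∈ Finset.range n, F.T (x i)) := (map_sum _ _ _).symm
  have hh : (F.nested M).h = F.h := rfl
  rw [evidence_eq, evidence_eq, hsum, hh, mul_assoc, mul_assoc, mul_div_mul_left _ _ hprod,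
    inv_mul_eq_div, inv_mul_eq_div]

variable {F M}
variable {θ τ : EuclideanSpace ℝ (Fin k)} {η υ : EuclideanSpace ℝ (Fin l)} {m w : ℝ}

theorem exists_abs_log_conjugateMass_div_sub_le (hF : F.IsFullRank)
    (hθ : θ ∈ interior F.naturalSpace) (hm : 0 < m)
    (hτ : m⁻¹ • τ ∈ interior (convexSupport ((F.law θ).map F.T))) {R : ℝ} (hR : 0 < R) :
    ∃ C, ∀ᶠ n : ℕ in atTop, ∀ s, ‖s - (n : ℝ) • F.mean θ‖ ≤ R * √n →
      0 < F.conjugateMass (τ + s) (m + n) / F.conjugateMass τ m ∧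
      |Real.log (F.conjugateMass (τ + s) (m + n) / F.conjugateMass τ m)
        - (F.conjugateExponent s n θ - k / 2 * Real.log n)| ≤ C := by
  have hprior := conjugateMass_prior_pos hθ hm hτ
  obtain ⟨C, hC⟩ := exists_abs_log_conjugateMass_sub_le hF hθ hm hτ hR
  refine ⟨C + |Real.log (F.conjugateMass τ m)|, ?_⟩
  filter_upwards [hC] with n hC s hs
  obtain ⟨hpost, hle⟩ := hC s hs
  refine ⟨div_pos hpost hprior, ?_⟩
  rw [Real.log_div hpost.ne' hprior.ne', sub_right_comm]
  exact (abs_sub _ _).trans (add_le_add_left hle _)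

theorem exists_abs_logBayesFactor_sub_le (hF : F.IsFullRank) (hM : M.rank = l)
    (hθ : θ ∈ interior F.naturalSpace) (hη : η ∈ interior (F.nested M).naturalSpace)
    (hmean : (F.nested M).mean η = M.toEuclideanLin (F.mean θ)) (hm : 0 < m) (hw : 0 < w)
    (hτ : m⁻¹ • τ ∈ interior (convexSupport ((F.law θ).map F.T)))
    (hυ : w⁻¹ • υ ∈ interior (convexSupport ((F.law θ).map (F.nested M).T)))
    {R : ℝ} (hR : 0 < R) :
    ∃ C, ∀ᶠ n : ℕ in atTop, ∀ x : ℕ → 𝒳, (∀ i, 0 < F.h (x i)) →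
      ‖∑ i ∈ Finset.range n, (F.T (x i) - F.mean θ)‖ ≤ R * √n →
      |F.logBayesFactor M τ m υ w n x - (n * F.divergence θ (M.transpose.toEuclideanLin η)
          - inner ℝ (∑ i ∈ Finset.range n, (F.T (x i) - F.mean θ))
            (M.transpose.toEuclideanLin η - θ))
        + ((k : ℝ) - l) / 2 * Real.log n| ≤ C := by
  set L := LinearMap.toContinuousLinearMap M.toEuclideanLin
  obtain ⟨C₁, h₁⟩ := exists_abs_log_conjugateMass_div_sub_le hF hθ hm hτ hR
  obtain ⟨C₂, h₂⟩ := exists_abs_log_conjugateMass_div_sub_le (isFullRank_nested hF hM) hη hw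
    (interior_mono (convexSupport_map_nested_T_subset F M θ η) hυ)
    (R := (‖L‖ + 1) * R) (by positivity)
  refine ⟨C₁ + C₂, ?_⟩
  filter_upwards [h₁, h₂] with n h₁ h₂ x hx hs
  set s := ∑ i ∈ Finset.range n, F.T (x i) with hs_def
  have hsum : ∑ i ∈ Finset.range n, (F.T (x i) - F.mean θ) = s - (n : ℝ) • F.mean θ := by
    rw [Finset.sum_sub_distrib, Finset.sum_const, Finset.card_range, ← Nat.cast_smul_eq_nsmul ℝ]
  rw [hsum] at hs ⊢
  have hLs : ‖L s - (n : ℝ) • (F.nested M).mean η‖ ≤ (‖L‖ + 1) * R * √n :=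
    calc ‖L s - (n : ℝ) • (F.nested M).mean η‖ = ‖L (s - (n : ℝ) • F.mean θ)‖ := by
          rw [hmean, map_sub, map_smul]; rfl
      _ ≤ ‖L‖ * (R * √n) := (L.le_opNorm _).trans (by gcongr)
      _ ≤ (‖L‖ + 1) * R * √n := by rw [mul_assoc]; gcongr; exact le_add_of_nonneg_right zero_le_one
  obtain ⟨hpos₁, hle₁⟩ := h₁ s hs
  obtain ⟨hpos₂, hle₂⟩ := h₂ (M.toEuclideanLin s) hLs
  rw [conjugateExponent_nested, conjugateExponent_eq_sub_divergence F s n θ] at hle₂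
  rw [logBayesFactor, evidence_div_evidence_nested F M hx, ← hs_def,
    Real.log_div hpos₁.ne' hpos₂.ne']
  refine le_of_eq_of_le (congrArg abs ?_) ((abs_sub _ _).trans (add_le_add hle₁ hle₂))
  ring

theorem exists_abs_logBayesFactor_sub_mul_divergence_le (hF : F.IsFullRank) (hM : M.rank = l)
    (hθ : θ ∈ interior F.naturalSpace) (hη : η ∈ interior (F.nested M).naturalSpace)
    (hmean : (F.nested M).mean η = M.toEuclideanLin (F.mean θ)) (hm : 0 < m) (hw : 0 < w)
    (hτ : m⁻¹ • τ ∈ interior (convexSupport ((F.law θ).map F.T)))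
    (hυ : w⁻¹ • υ ∈ interior (convexSupport ((F.law θ).map (F.nested M).T)))
    {R : ℝ} (hR : 0 < R) :
    ∃ C, ∀ᶠ n : ℕ in atTop, ∀ x : ℕ → 𝒳, (∀ i, 0 < F.h (x i)) →
      ‖∑ i ∈ Finset.range n, (F.T (x i) - F.mean θ)‖ ≤ R * √n →
      |F.logBayesFactor M τ m υ w n x - n * F.divergence θ (M.transpose.toEuclideanLin η)|
        ≤ C * √n := by
  obtain ⟨C, hC⟩ := exists_abs_logBayesFactor_sub_le hF hM hθ hη hmean hm hw hτ hυ hR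
  set v := M.transpose.toEuclideanLin η - θ
  refine ⟨|C| + R * ‖v‖ + |(k : ℝ) - l|, ?_⟩
  filter_upwards [hC, eventually_ge_atTop 1] with n hC hn x hx hs
  have hsqrt : 1 ≤ √(n : ℝ) := Real.one_le_sqrt.2 (Nat.one_le_cast.2 hn)
  have hinner : |inner ℝ (∑ i ∈ Finset.range n, (F.T (x i) - F.mean θ)) v| ≤ R * ‖v‖ * √n :=
    (abs_real_inner_le_norm _ _).trans (by rw [mul_right_comm]; gcongr)
  have hlog : |((k : ℝ) - l) / 2 * Real.log n| ≤ |(k : ℝ) - l| * √n := by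
    have hlog_le : Real.log n ≤ 2 * √n := by
      linarith [Real.log_sqrt n.cast_nonneg, Real.log_le_self (Real.sqrt_nonneg n)]
    rw [abs_mul, abs_div, abs_two, abs_of_nonneg (Real.log_natCast_nonneg n)]
    nlinarith [abs_nonneg ((k : ℝ) - l)]
  have hconst : C ≤ |C| * √n := (le_abs_self C).trans (le_mul_of_one_le_right (abs_nonneg C) hsqrt)
  have hle := abs_le.1 (hC x hx hs)
  rw [abs_le] at hinner hlog ⊢
  constructor <;> linarith

variable {Ω : Type*} [MeasurableSpace Ω] {P : Measure Ω} {X : ℕ → Ω → 𝒳}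

theorem boundedInProbability_inv_sqrt_smul_sum_T_sub_mean (hθ : θ ∈ interior F.naturalSpace)
    (hX_law : ∀ i, HasLaw (X i) (F.law θ) P)
    (hX_indep : Pairwise fun i j => IndepFun (X i) (X j) P) :
    BoundedInProbability P fun n ω =>
      (√(n : ℝ))⁻¹ • ∑ i ∈ Finset.range n, (F.T (X i ω) - F.mean θ) := by
  have := F.isProbabilityMeasure_law (interior_subset hθ)
  have := (hX_law 0).isProbabilityMeasure
  have hmeas : Measurable fun x => F.T x - F.mean θ := F.measurable_T.sub_const _
  refine boundedInProbability_inv_sqrt_smul_sum (V := ∫ x, ‖F.T x - F.mean θ‖ ^ 2 ∂(F.law θ))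
    (fun i => ?_) (fun i => ?_) (fun i => ?_) fun i j hij => (hX_indep hij).comp hmeas hmeas
  · have hLp := memLp_T_sub hθ (F.mean θ)
    rw [← (hX_law i).map_eq] at hLp
    exact hLp.comp_of_map (hX_law i).aemeasurable
  · exact ((hX_law i).integral_comp hmeas.aestronglyMeasurable).trans
      ((integral_T_sub hθ _).trans (sub_self _))
  · exact ((hX_law i).integral_comp (hmeas.norm.pow_const 2).aestronglyMeasurable).le

theorem boundedInProbability_of_forall_bound (hθ : θ ∈ interior F.naturalSpace)
    (hX_law : ∀ i, HasLaw (X i) (F.law θ) P)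
    (hX_indep : Pairwise fun i j => IndepFun (X i) (X j) P) {f : ℕ → (ℕ → 𝒳) → ℝ}
    (h : ∀ R > 0, ∃ C, ∀ᶠ n : ℕ in atTop, ∀ x : ℕ → 𝒳, (∀ i, 0 < F.h (x i)) →
      ‖∑ i ∈ Finset.range n, (F.T (x i) - F.mean θ)‖ ≤ R * √n → |f n x| ≤ C) :
    BoundedInProbability P fun n ω => f n fun i => X i ω := by
  have hpos : ∀ᵐ ω ∂P, ∀ i, 0 < F.h (X i ω) := ae_all_iff.2 fun i =>
    ((hX_law i).ae_iff (measurable_const.lt F.measurable_h)).2 (F.ae_h_pos θ)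
  refine (boundedInProbability_inv_sqrt_smul_sum_T_sub_mean hθ hX_law hX_indep).of_forall_bound
    fun R hR => ?_
  obtain ⟨C, hC⟩ := h R hR
  refine ⟨C, ?_⟩
  filter_upwards [hC, eventually_gt_atTop 0] with n hC hn₀
  filter_upwards [hpos] with ω hω hR
  have hsqrt : 0 < √(n : ℝ) := Real.sqrt_pos.2 (Nat.cast_pos.2 hn₀)
  refine hC _ hω ?_
  rwa [norm_smul, norm_inv, Real.norm_of_nonneg hsqrt.le, inv_mul_le_iff₀ hsqrt, mul_comm] at hR

theorem tendstoInMeasure_inv_mul_logBayesFactor (hF : F.IsFullRank) (hM : M.rank = l)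
    (hθ : θ ∈ interior F.naturalSpace) (hη : η ∈ interior (F.nested M).naturalSpace)
    (hmean : (F.nested M).mean η = M.toEuclideanLin (F.mean θ)) (hm : 0 < m) (hw : 0 < w)
    (hτ : m⁻¹ • τ ∈ interior (convexSupport ((F.law θ).map F.T)))
    (hυ : w⁻¹ • υ ∈ interior (convexSupport ((F.law θ).map (F.nested M).T)))
    (hX_law : ∀ i, HasLaw (X i) (F.law θ) P)
    (hX_indep : Pairwise fun i j => IndepFun (X i) (X j) P) :
    TendstoInMeasure P
      (fun (n : ℕ) ω => (n : ℝ)⁻¹ * F.logBayesFactor M τ m υ w n fun i => X i ω) atTop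
      fun _ => F.divergence θ (M.transpose.toEuclideanLin η) := by
  set D := F.divergence θ (M.transpose.toEuclideanLin η)
  have hbdd : BoundedInProbability P fun n ω =>
      (√(n : ℝ))⁻¹ * (F.logBayesFactor M τ m υ w n (fun i => X i ω) - n * D) := by
    refine boundedInProbability_of_forall_bound hθ hX_law hX_indep
      (f := fun n x => (√(n : ℝ))⁻¹ * (F.logBayesFactor M τ m υ w n x - n * D)) fun R hR => ?_
    obtain ⟨C, hC⟩ :=
      exists_abs_logBayesFactor_sub_mul_divergence_le hF hM hθ hη hmean hm hw hτ hυ hR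
    refine ⟨C, ?_⟩
    filter_upwards [hC, eventually_gt_atTop 0] with n hC hn₀ x hx hs
    rw [abs_mul, abs_inv, abs_of_nonneg (Real.sqrt_nonneg _), inv_mul_le_iff₀ (by positivity),
      mul_comm _ C]
    exact hC x hx hs
  refine hbdd.tendstoInMeasure (r := fun n => (√(n : ℝ))⁻¹)
    (tendsto_inv_atTop_zero.comp (Real.tendsto_sqrt_atTop.comp tendsto_natCast_atTop_atTop)) ?_
  filter_upwards [eventually_gt_atTop 0] with n hn₀ ω
  have hn : (0 : ℝ) < n := Nat.cast_pos.2 hn₀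
  have hinv : (0 : ℝ) ≤ (√(n : ℝ))⁻¹ := by positivity
  rw [← Real.norm_of_nonneg hinv, ← norm_mul, Real.norm_of_nonneg hinv, ← mul_assoc, ← mul_inv,
    Real.mul_self_sqrt hn.le, mul_sub, inv_mul_cancel_left₀ hn.ne']

theorem tendstoInMeasure_inv_log_mul_logBayesFactor (hF : F.IsFullRank) (hM : M.rank = l)
    (hθ : M.transpose.toEuclideanLin η ∈ interior F.naturalSpace)
    (hη : η ∈ interior (F.nested M).naturalSpace) (hm : 0 < m) (hw : 0 < w)
    (hτ : m⁻¹ • τ ∈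
      interior (convexSupport ((F.law (M.transpose.toEuclideanLin η)).map F.T)))
    (hυ : w⁻¹ • υ ∈
      interior (convexSupport ((F.law (M.transpose.toEuclideanLin η)).map (F.nested M).T)))
    (hX_law : ∀ i, HasLaw (X i) (F.law (M.transpose.toEuclideanLin η)) P)
    (hX_indep : Pairwise fun i j => IndepFun (X i) (X j) P) :
    TendstoInMeasure P
      (fun (n : ℕ) ω => (Real.log n)⁻¹ * F.logBayesFactor M τ m υ w n fun i => X i ω) atTop
      fun _ => -((k : ℝ) - l) / 2 := by
  have hbdd : BoundedInProbability P fun n ω =>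
      F.logBayesFactor M τ m υ w n (fun i => X i ω) + ((k : ℝ) - l) / 2 * Real.log n := by
    refine boundedInProbability_of_forall_bound hθ hX_law hX_indep
      (f := fun n x => F.logBayesFactor M τ m υ w n x + ((k : ℝ) - l) / 2 * Real.log n)
      fun R hR => ?_
    simpa only [divergence, sub_self, inner_zero_right, mul_zero, sub_zero] using
      exists_abs_logBayesFactor_sub_le hF hM hθ hη (mean_nested hθ) hm hw hτ hυ hR
  have hlog : Tendsto (fun n : ℕ => Real.log n) atTop atTop :=
    Real.tendsto_log_atTop.comp tendsto_natCast_atTop_atTop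
  refine hbdd.tendstoInMeasure (r := fun n => (Real.log n)⁻¹)
    (tendsto_inv_atTop_zero.comp hlog) ?_
  filter_upwards [hlog.eventually_gt_atTop 0] with n hn ω
  have hinv : 0 ≤ (Real.log n)⁻¹ := by positivity
  rw [← Real.norm_of_nonneg hinv, ← norm_mul, Real.norm_of_nonneg hinv, mul_add,
    mul_comm _ (_ / 2 * _), mul_inv_cancel_right₀ hn.ne', neg_div, sub_neg_eq_add]

end BayesFactor

end ExpFamily

theorem theorem2_general {𝒳 : Type*} [MeasurableSpace 𝒳] {k l : ℕ} (hlk : l < k)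
    (F : ExpFamily 𝒳 k) (hF : F.IsFullRank)
    (M : Matrix (Fin l) (Fin k) ℝ) (hM : M.rank = l)
    (hE : IsOpen (F.nested M).naturalSpace) (hE_ne : (F.nested M).naturalSpace.Nonempty)
    (θ₀ : EuclideanSpace ℝ (Fin k)) (hθ₀ : θ₀ ∈ interior F.naturalSpace)
    (m w : ℝ) (hm : 0 < m) (hw : 0 < w)
    (τ : EuclideanSpace ℝ (Fin k)) (υ : EuclideanSpace ℝ (Fin l))
    (hτ : m⁻¹ • τ ∈ interior (convexSupport ((F.law θ₀).map F.T)))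
    (hυ : w⁻¹ • υ ∈ interior
      (convexSupport ((F.law θ₀).map fun x => M.toEuclideanLin (F.T x))))
    {Ω : Type*} [MeasurableSpace Ω] (P : Measure Ω)
    (X : ℕ → Ω → 𝒳) (hX_law : ∀ i, HasLaw (X i) (F.law θ₀) P)
    (hX_indep : Pairwise fun i j => IndepFun (X i) (X j) P) :
    (θ₀ ∉ M.transpose.toEuclideanLin '' (F.nested M).naturalSpace →
      ∃ η₀ ∈ (F.nested M).naturalSpace,
        gradient (F.nested M).logPartition η₀
          = M.toEuclideanLin (gradient F.logPartition θ₀) ∧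
        (∀ η ∈ (F.nested M).naturalSpace,
          gradient (F.nested M).logPartition η
            = M.toEuclideanLin (gradient F.logPartition θ₀) → η = η₀) ∧
        TendstoInMeasure P
          (fun (n : ℕ) ω => (n : ℝ)⁻¹ * Real.log
            (F.evidence τ m n (fun i => X i ω) / (F.nested M).evidence υ w n (fun i => X i ω)))
          atTop
          (fun _ => inner ℝ (θ₀ - M.transpose.toEuclideanLin η₀) (gradient F.logPartition θ₀)
            - (F.logPartition θ₀ - F.logPartition (M.transpose.toEuclideanLin η₀))) ∧
        0 < inner ℝ (θ₀ - M.transpose.toEuclideanLin η₀) (gradient F.logPartition θ₀)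
            - (F.logPartition θ₀ - F.logPartition (M.transpose.toEuclideanLin η₀))) ∧
    (θ₀ ∈ M.transpose.toEuclideanLin '' (F.nested M).naturalSpace →
      TendstoInMeasure P
        (fun (n : ℕ) ω => (Real.log n)⁻¹ * Real.log
          (F.evidence τ m n (fun i => X i ω) / (F.nested M).evidence υ w n (fun i => X i ω)))
        atTop (fun _ => -((k : ℝ) - (l : ℝ)) / 2) ∧
      -((k : ℝ) - (l : ℝ)) / 2 < 0) := by
  have hE_mem {η} (hη : η ∈ (F.nested M).naturalSpace) :
      η ∈ interior (F.nested M).naturalSpace := by rwa [hE.interior_eq]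
  refine ⟨fun hnot => ?_, fun ⟨η₀, hη₀, hη₀_eq⟩ => ⟨?_, ?_⟩⟩
  · obtain ⟨η₀, hη₀, hmean⟩ := ExpFamily.exists_mean_nested_eq hF hE hE_ne hθ₀
    have hgrad {η} (hη : η ∈ (F.nested M).naturalSpace) :=
      ExpFamily.gradient_logPartition (hE_mem hη)
    have hη₀_mem : M.transpose.toEuclideanLin η₀ ∈ F.naturalSpace := by
      rwa [ExpFamily.naturalSpace_nested] at hη₀
    simp only [ExpFamily.gradient_logPartition hθ₀, ← ExpFamily.divergence_eq_inner_sub]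
    refine ⟨η₀, hη₀, (hgrad hη₀).trans hmean, fun η hη h => ?_, ?_, ?_⟩
    · exact ExpFamily.injOn_mean (ExpFamily.isFullRank_nested hF hM) (hE_mem hη) (hE_mem hη₀)
        ((hgrad hη).symm.trans (h.trans hmean.symm))
    · exact ExpFamily.tendstoInMeasure_inv_mul_logBayesFactor hF hM hθ₀ (hE_mem hη₀) hmean hm hw
        hτ hυ hX_law hX_indep
    · exact ExpFamily.divergence_pos hF hθ₀ hη₀_mem fun h => hnot ⟨η₀, hη₀, h⟩
  · subst hη₀_eq
    exact ExpFamily.tendstoInMeasure_inv_log_mul_logBayesFactor hF hM hθ₀ (hE_mem hη₀) hm hw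
      hτ hυ hX_law hX_indep
  · have : (l : ℝ) < k := Nat.cast_lt.2 hlk
    linarith

theorem theorem2 {𝒳 : Type*} [MeasurableSpace 𝒳] {k l : ℕ} (hlk : l < k)
    (F : ExpFamily 𝒳 k) (hF : F.IsFullRank)
    (M : Matrix (Fin l) (Fin k) ℝ) (hM : M.rank = l)
    (hΘ : IsOpen F.naturalSpace)
    (hE : IsOpen (F.nested M).naturalSpace) (hE_ne : (F.nested M).naturalSpace.Nonempty)
    (θ₀ : EuclideanSpace ℝ (Fin k)) (hθ₀ : θ₀ ∈ F.naturalSpace)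
    (m w : ℝ) (hm : 0 < m) (hw : 0 < w)
    (τ : EuclideanSpace ℝ (Fin k)) (υ : EuclideanSpace ℝ (Fin l))
    (hτ : m⁻¹ • τ ∈ interior (convexSupport ((F.law θ₀).map F.T)))
    (hυ : w⁻¹ • υ ∈ interior
      (convexSupport ((F.law θ₀).map fun x => M.toEuclideanLin (F.T x))))
    {Ω : Type*} [MeasurableSpace Ω] (P : Measure Ω) [IsProbabilityMeasure P]
    (X : ℕ → Ω → 𝒳) (hX_law : ∀ i, HasLaw (X i) (F.law θ₀) P) (hX_indep : iIndepFun X P) :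
    (θ₀ ∉ M.transpose.toEuclideanLin '' (F.nested M).naturalSpace →
      ∃ η₀ ∈ (F.nested M).naturalSpace,
        gradient (F.nested M).logPartition η₀
          = M.toEuclideanLin (gradient F.logPartition θ₀) ∧
        (∀ η ∈ (F.nested M).naturalSpace,
          gradient (F.nested M).logPartition η
            = M.toEuclideanLin (gradient F.logPartition θ₀) → η = η₀) ∧
        TendstoInMeasure P
          (fun (n : ℕ) ω => (n : ℝ)⁻¹ * Real.log
            (F.evidence τ m n (fun i => X i ω) / (F.nested M).evidence υ w n (fun i => X i ω)))
          atTop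
          (fun _ => inner ℝ (θ₀ - M.transpose.toEuclideanLin η₀) (gradient F.logPartition θ₀)
            - (F.logPartition θ₀ - F.logPartition (M.transpose.toEuclideanLin η₀))) ∧
        0 < inner ℝ (θ₀ - M.transpose.toEuclideanLin η₀) (gradient F.logPartition θ₀)
            - (F.logPartition θ₀ - F.logPartition (M.transpose.toEuclideanLin η₀))) ∧
    (θ₀ ∈ M.transpose.toEuclideanLin '' (F.nested M).naturalSpace →
      TendstoInMeasure P
        (fun (n : ℕ) ω => (Real.log n)⁻¹ * Real.log
          (F.evidence τ m n (fun i => X i ω) / (F.nested M).evidence υ w n (fun i => X i ω)))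
        atTop (fun _ => -((k : ℝ) - (l : ℝ)) / 2) ∧
      -((k : ℝ) - (l : ℝ)) / 2 < 0) := by
  exact theorem2_general hlk F hF M hM hE hE_ne θ₀ (by rwa [hΘ.interior_eq]) m w hm hw τ υ hτ hυ P X
    hX_law fun _ _ hij => hX_indep.indepFun hij
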